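/- Let $d$ be a prime, $\mathcal H$ a $d$-dimensional Hilbert space with orthonormal basis $|0\rangle,\dots,|d-1\rangle$, $\omega$ a primitive $d$-th root of unity, and let $X|j\rangle=|(j-1)\bmod d\rangle$, $Z|j\rangle=\omega^j|j\rangle$. Put $\mathcal X=\{0,\dots,d-1\}^2$, $N_{(i,j)}=X^iZ^j$, and $N_x=N_{x_1}\otimes\cdots\otimes N_{x_n}$ for $x\in\mathcal X^n$. Let $p$ be a probability distribution on $\mathcal X$, let $P(v|u)$, $u,v\in\mathcal X$, be transition probabilities, and set $$P_n(x_1,\dots,x_n)=p(x_1)\prod_{j=1}^{n-1}P(x_{j+1}|x_j).$$ Let $\mathcal A_n$ be the channel $\mathcal A_n(\rho)=\sum_{x\in\mathcal X^n}P_n(x)\,N_x\rho N_x^\dagger$ on the operators on $\mathcal H^{\otimes n}$, $n=1,2,\dots$. For real $k\ge 0$ let $F^\star_{n,k}(\mathcal A_n)$ be the supremum, over all subspaces $\mathcal C\subset\mathcal H^{\otimes n}$ with $\log_d\dim\mathcal C\ge k$ and all trace-preserving completely positive linear maps $\mathcal R$ on the operators on $\mathcal H^{\otimes n}$, of $$\min_{|\psi\rangle\in\mathcal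 C,\ \|\psi\|=1}\langle\psi|\,\mathcal R\mathcal A_n(|\psi\rangle\langle\psi|)\,|\psi\rangle .$$ For a probability distribution $Q$ on $\mathcal X^2$ let $\bar Q(u)=\sum_vQ(u,v)$ and $\bar{\bar Q}(u)=\sum_vQ(v,u)$ be its marginals, $\overleftarrow Q(v|u)=Q(u,v)/\bar Q(u)$ for $\bar Q(u)>0$, and $$D(Q\|P)=\sum_{u:\bar Q(u)>0}\sum_vQ(u,v)\log_d\frac{\overleftarrow Q(v|u)}{P(v|u)},\qquad H(\overleftarrow Q|\bar Q)=-\sum_{u:\bar Q(u)>0}\sum_v\bar Q(u)\overleftarrow Q(v|u)\log_d\overleftarrow Q(v|u),$$ with the conventions $\log(a/0)=\infty$ for $a>0$ and $0\log0=0\log(0/0)=0$. Then for every $0\le R\le1$ $$\liminf_{n\to\infty}-\frac1n\log_d\bigl[1-F^\star_{n,Rn}(\mathcal A_n)\bigr]\ \ge\ E(R,P),$$ where $$E(R,P)=\min_{Q:\ \bar Q=\bar{\bar Q}}\Bigl[D(Q\|P)+\bigl|1-H(\overleftarrow Q|\bar Q)-R\bigr|^+\Bigr],\qquad |x|^+=\max\{x,0\},$$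 the minimum being over all probability distributions $Q$ on $\mathcal X^2$ with $\bar Q=\bar{\bar Q}$ (and being attained), and $-\log_d 0=+\infty$. -/

import Mathlib

noncomputable section

namespace WeylChannel

open Matrix
open scoped ComplexOrder

/-! ### Quantum operations on a finite-dimensional Hilbert space with orthonormal basis `ι`

Operators are complex matrices with respect to the basis, vectors are functions `ι → ℂ`. -/

section Operations

variable {ι κ : Type*} [Fintype ι] [Fintype κ]

/-- The map `ρ ↦ ∑ i, M i * ρ * (M i)†` given by a finite family of operators. -/
def krausMap (M : κ → Matrix ι ι ℂ) : Matrix ι ι ℂ →ₗ[ℂ] Matrix ι ι ℂ where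
  toFun ρ := ∑ i, M i * ρ * (M i)ᴴ
  map_add' ρ σ := by simp [Matrix.mul_add, Matrix.add_mul, Finset.sum_add_distrib]
  map_smul' c ρ := by simp [Finset.smul_sum]

/-- The extension `id ⊗ Φ` of `Φ` to operators on `ℂ^k ⊗ ℂ^ι`: apply `Φ` to every block. -/
def ampliation (k : ℕ) (Φ : Matrix ι ι ℂ →ₗ[ℂ] Matrix ι ι ℂ)
    (ρ : Matrix (Fin k × ι) (Fin k × ι) ℂ) : Matrix (Fin k × ι) (Fin k × ι) ℂ :=
  Matrix.of fun a b => Φ (Matrix.of fun i j => ρ (a.1, i) (b.1, j)) a.2 b.2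

/-- Trace-preserving completely positive linear maps. -/
structure IsTPCP (Φ : Matrix ι ι ℂ →ₗ[ℂ] Matrix ι ι ℂ) : Prop where
  trace_preserving : ∀ ρ, (Φ ρ).trace = ρ.trace
  completely_positive : ∀ (k : ℕ) (ρ : Matrix (Fin k × ι) (Fin k × ι) ℂ),
    ρ.PosSemidef → (ampliation k Φ ρ).PosSemidef

/-- `⟨ψ| Φ(|ψ⟩⟨ψ|) |ψ⟩`; this number is real when `Φ` is positive. -/
def fidelity (Φ : Matrix ι ι ℂ →ₗ[ℂ] Matrix ι ι ℂ) (ψ : ι → ℂ) : ℝ :=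
  (star ψ ⬝ᵥ (Φ (vecMulVec ψ (star ψ)) *ᵥ ψ)).re

/-- The minimum of the fidelity over the normalized vectors of the subspace `C`. -/
def minFidelity (C : Submodule ℂ (ι → ℂ)) (Φ : Matrix ι ι ℂ →ₗ[ℂ] Matrix ι ι ℂ) : ℝ :=
  sInf (fidelity Φ '' {ψ | ψ ∈ C ∧ star ψ ⬝ᵥ ψ = 1})

/-- The supremum of the minimum fidelity over all codes `(C, 𝓡)` with `log_d dim C ≥ k`;
`C` is nonzero, since `log_d 0 = -∞`. -/
def bestFidelity (d : ℕ) (k : ℝ) (A : Matrix ι ι ℂ →ₗ[ℂ] Matrix ι ι ℂ) : ℝ :=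
  sSup {f | ∃ (C : Submodule ℂ (ι → ℂ)) (𝓡 : Matrix ι ι ℂ →ₗ[ℂ] Matrix ι ι ℂ),
    C ≠ ⊥ ∧ k ≤ Real.logb d (Module.finrank ℂ C) ∧ IsTPCP 𝓡 ∧ f = minFidelity C (𝓡 ∘ₗ A)}

end Operations

/-! ### Weyl operators and the channel -/

/-- The alphabet `{0, …, d-1}²`. -/
abbrev Alphabet (d : ℕ) : Type := ZMod d × ZMod d

/-- `X |j⟩ = |j - 1 mod d⟩`. -/
def weylX (d : ℕ) : Matrix (ZMod d) (ZMod d) ℂ :=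
  Matrix.of fun i j => if i = j - 1 then 1 else 0

/-- `Z |j⟩ = ω ^ j |j⟩`. -/
def weylZ (d : ℕ) (ω : ℂ) : Matrix (ZMod d) (ZMod d) ℂ :=
  Matrix.diagonal fun j => ω ^ j.val

/-- `N_(i,j) = X ^ i Z ^ j`. -/
def weylN {d : ℕ} [NeZero d] (ω : ℂ) (u : Alphabet d) : Matrix (ZMod d) (ZMod d) ℂ :=
  weylX d ^ u.1.val * weylZ d ω ^ u.2.val

/-- `N_x = N_{x₁} ⊗ ⋯ ⊗ N_{xₙ}`, in the product basis `|j₁⟩ ⊗ ⋯ ⊗ |jₙ⟩`, `j : Fin n → ZMod d`. -/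
def weylTensor {d n : ℕ} [NeZero d] (ω : ℂ) (x : Fin n → Alphabet d) :
    Matrix (Fin n → ZMod d) (Fin n → ZMod d) ℂ :=
  Matrix.of fun a b => ∏ i, weylN ω (x i) (a i) (b i)

/-- `Pₙ(x₁, …, xₙ) = p(x₁) ∏ P(x_{j+1} | x_j)`, where `P u v` stands for `P(v|u)`. -/
def markovDist {𝒳 : Type*} (p : 𝒳 → ℝ) (P : 𝒳 → 𝒳 → ℝ) : (n : ℕ) → (Fin n → 𝒳) → ℝ
  | 0, _ => 1
  | m + 1, x => p (x 0) * ∏ j : Fin m, P (x j.castSucc) (x j.succ)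

/-- The channel `𝓐ₙ ∼ {√Pₙ(x) N_x}` on `n` qudits. -/
def markovChannel {d : ℕ} [NeZero d] (ω : ℂ) (p : Alphabet d → ℝ)
    (P : Alphabet d → Alphabet d → ℝ) (n : ℕ) :
    Matrix (Fin n → ZMod d) (Fin n → ZMod d) ℂ →ₗ[ℂ]
      Matrix (Fin n → ZMod d) (Fin n → ZMod d) ℂ :=
  krausMap fun x : Fin n → Alphabet d => (√(markovDist p P n x) : ℂ) • weylTensor ω x

/-! ### Information quantities (all logarithms to base `d`) -/

section Information

variable {𝒳 : Type*} [Fintype 𝒳]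

/-- The first marginal `Q̄`. -/
def marginalFst (Q : 𝒳 × 𝒳 → ℝ) (u : 𝒳) : ℝ := ∑ v, Q (u, v)

/-- The second marginal. -/
def marginalSnd (Q : 𝒳 × 𝒳 → ℝ) (u : 𝒳) : ℝ := ∑ v, Q (v, u)

/-- The conditional probability `Q(u, v) / Q̄(u)` of `v` given `u`; only used for `Q̄(u) > 0`. -/
def condProb (Q : 𝒳 × 𝒳 → ℝ) (u v : 𝒳) : ℝ := Q (u, v) / marginalFst Q u

/-- The term `a log_d (b / c)` with the conventions `0 log (0 / 0) = 0 log 0 = 0` and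
`log (b / 0) = ∞` for `b > 0`. -/
def divergenceTerm (d : ℕ) (a b c : ℝ) : EReal :=
  if a = 0 then 0 else if c = 0 then ⊤ else ((a * Real.logb d (b / c) : ℝ) : EReal)

/-- The conditional Kullback–Leibler information `D(Q‖P)`. -/
def divergence (d : ℕ) (Q : 𝒳 × 𝒳 → ℝ) (P : 𝒳 → 𝒳 → ℝ) : EReal :=
  ∑ u with 0 < marginalFst Q u, ∑ v, divergenceTerm d (Q (u, v)) (condProb Q u v) (P u v)

/-- The entropy `H(P|p)` of `P(·|·)` conditional on `p` (`Real.logb d 0 = 0`, so `0 log 0 = 0`). -/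
def condEntropy (d : ℕ) (P : 𝒳 → 𝒳 → ℝ) (p : 𝒳 → ℝ) : ℝ :=
  -∑ u with 0 < p u, ∑ v, p u * P u v * Real.logb d (P u v)

/-- Probability distributions on `𝒳²` whose two marginals coincide. -/
def balanced (𝒳 : Type*) [Fintype 𝒳] : Set (𝒳 × 𝒳 → ℝ) :=
  {Q | Q ∈ stdSimplex ℝ (𝒳 × 𝒳) ∧ marginalFst Q = marginalSnd Q}

/-- `D(Q‖P) + |1 - H(Q(·|·) | Q̄) - R|⁺`. -/
def exponentObjective (d : ℕ) (R : ℝ) (P : 𝒳 → 𝒳 → ℝ) (Q : 𝒳 × 𝒳 → ℝ) : EReal :=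
  divergence d Q P +
    ((max (1 - condEntropy d (condProb Q) (marginalFst Q) - R) 0 : ℝ) : EReal)

end Information

/-- `log_d x` for `x ≥ 0`, with `log_d 0 = -∞`. -/
def elogb (d : ℕ) (x : ℝ) : EReal :=
  if x = 0 then ⊥ else (Real.logb d x : EReal)

end WeylChannel

end

/-! The quantum problem reduces to a classical decoding problem. Weyl operators commute up to a
phase given by a symplectic form, so `r` mutually orthogonal generators split the space into joint
eigenspaces. One of these has dimension at least `d^(n-r)`; it is the code. An error `x` carries it
into the eigenspace labelled by the syndrome of `x`. Measuring the label and undoing a guessed error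
restores every code vector if the guess is `x`, so `1 - F` is at most the probability of a wrong
guess (`sum_correctable_le_bestFidelity`).

The generators are drawn at random as `(v, S v)` with `S` symmetric, which makes them orthogonal
automatically. A fixed nonzero difference of errors has zero syndrome with probability at most `2
d^(-r)` (`card_undetected_mul_le`). A union bound over competing errors, truncated at `1`, and
averaging over the draw give `one_sub_bestFidelity_le` for a decoder minimizing any score.

The score is the empirical conditional entropy, so the decoder does not depend on `P`. For a
sequence with `m` transitions and pair type `Q` compatible with `P`, the probability is at most
`d^(-m(D+H))`. Up to a polynomial factor, at most `d^(mH)` sequences have entropy at most `H`. The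
truncated union bound therefore becomes `d^(-m|1-H-R|⁺)`, and summing over the polynomially many
types leaves the worst exponent (`sum_markovDist_mul_min_le`).

The marginals of a pair type agree only up to `1/m`. Compactness and continuity show that the
exponent on such almost balanced types is asymptotically no smaller than on balanced ones
(`exists_pos_lt_realObjective`). -/

noncomputable section

namespace WeylChannel

open Matrix Filter
open scoped ComplexOrder

/-! ### Empirical pair types of sequences -/

section Types

variable {𝒳 : Type*} {m : ℕ}

/-- The number of times the transition `w` occurs in the sequence `x`. -/
def transitionCount [DecidableEq 𝒳] (x : Fin (m + 1) → 𝒳) (w : 𝒳 × 𝒳) : ℕ :=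
  (Finset.univ.filter fun j : Fin m => (x j.castSucc, x j.succ) = w).card

/-- The empirical distribution of the transitions of `x`. -/
def pairType [DecidableEq 𝒳] (x : Fin (m + 1) → 𝒳) (w : 𝒳 × 𝒳) : ℝ := transitionCount x w / m

/-- The empirical conditional entropy of `x`. -/
def typeEntropy [Fintype 𝒳] [DecidableEq 𝒳] (d : ℕ) (x : Fin (m + 1) → 𝒳) : ℝ :=
  condEntropy d (condProb (pairType x)) (marginalFst (pairType x))

lemma transitionCount_le [DecidableEq 𝒳] (x : Fin (m + 1) → 𝒳)
    (w : 𝒳 × 𝒳) : transitionCount x w ≤ m := by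
  simpa [transitionCount] using Finset.card_filter_le (Finset.univ : Finset (Fin m))
    (fun j : Fin m => (x j.castSucc, x j.succ) = w)

/-- Averages over the type are time averages along the path; suitable choices of `f` give total
mass, marginals and log-probabilities. -/
lemma sum_pairType_mul [Fintype 𝒳] [DecidableEq 𝒳] (x : Fin (m + 1) → 𝒳) (f : 𝒳 × 𝒳 → ℝ) :
    ∑ w, pairType x w * f w = (∑ j : Fin m, f (x j.castSucc, x j.succ)) / m := by
  have h : ∀ w, pairType x w * f w
      = (∑ j : Fin m, if (x j.castSucc, x j.succ) = w then f w else 0) / m := by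
    intro w
    rw [pairType, transitionCount, ← Finset.sum_filter, Finset.sum_const, nsmul_eq_mul]
    ring
  simp_rw [h]
  rw [← Finset.sum_div, Finset.sum_comm]
  simp

lemma pairType_nonneg [DecidableEq 𝒳] (x : Fin (m + 1) → 𝒳) (w : 𝒳 × 𝒳) : 0 ≤ pairType x w := by
  unfold pairType; positivity

lemma pairType_mem_stdSimplex [Fintype 𝒳] [DecidableEq 𝒳] (hm : 0 < m) (x : Fin (m + 1) → 𝒳) :
    pairType x ∈ stdSimplex ℝ (𝒳 × 𝒳) := by
  refine ⟨pairType_nonneg x, ?_⟩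
  have := sum_pairType_mul x (fun _ => 1)
  simp only [mul_one] at this
  rw [this]
  have : (m : ℝ) ≠ 0 := by positivity
  simp [this]

lemma marginalFst_pairType [Fintype 𝒳] [DecidableEq 𝒳] (x : Fin (m + 1) → 𝒳) (u : 𝒳) :
    marginalFst (pairType x) u = (∑ j : Fin m, if x j.castSucc = u then (1 : ℝ) else 0) / m := by
  have := sum_pairType_mul x (fun w => if w.1 = u then 1 else 0)
  rw [← this, Fintype.sum_prod_type, marginalFst, Finset.sum_comm]
  simp

lemma marginalSnd_pairType [Fintype 𝒳] [DecidableEq 𝒳] (x : Fin (m + 1) → 𝒳) (u : 𝒳) :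
    marginalSnd (pairType x) u = (∑ j : Fin m, if x j.succ = u then (1 : ℝ) else 0) / m := by
  have := sum_pairType_mul x (fun w => if w.2 = u then 1 else 0)
  rw [← this, Fintype.sum_prod_type, marginalSnd]
  simp

/-- The marginals count visits among all letters but the last and all letters but the first, so only
the two endpoints contribute to the difference. This is the source of the constraint of equal
marginals in the exponent. -/
lemma abs_marginal_sub_le [Fintype 𝒳] [DecidableEq 𝒳] (x : Fin (m + 1) → 𝒳) (u : 𝒳) :
    |marginalFst (pairType x) u - marginalSnd (pairType x) u| ≤ 1 / m := by
  rw [marginalFst_pairType, marginalSnd_pairType, ← sub_div, abs_div, Nat.abs_cast]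
  gcongr
  have h1 := Fin.sum_univ_castSucc (fun j : Fin (m + 1) => if x j = u then (1 : ℝ) else 0)
  have h2 := Fin.sum_univ_succ (fun j : Fin (m + 1) => if x j = u then (1 : ℝ) else 0)
  have h3 : (∑ j : Fin m, if x j.castSucc = u then (1 : ℝ) else 0)
      - (∑ j : Fin m, if x j.succ = u then (1 : ℝ) else 0)
      = (if x 0 = u then (1 : ℝ) else 0) - (if x (Fin.last m) = u then (1 : ℝ) else 0) := by
    linarith
  rw [h3]
  split_ifs <;> simp

lemma pairType_pos [DecidableEq 𝒳] (hm : 0 < m) (x : Fin (m + 1) → 𝒳) (j : Fin m) :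
    0 < pairType x (x j.castSucc, x j.succ) := by
  unfold pairType
  have : 0 < transitionCount x (x j.castSucc, x j.succ) :=
    Finset.card_pos.mpr ⟨j, by simp⟩
  positivity

lemma le_marginalFst [Fintype 𝒳] {Q : 𝒳 × 𝒳 → ℝ} (hQ : ∀ w, 0 ≤ Q w) (u v : 𝒳) :
    Q (u, v) ≤ marginalFst Q u :=
  Finset.single_le_sum (f := fun v => Q (u, v)) (fun v _ => hQ (u, v)) (Finset.mem_univ v)

lemma marginalFst_nonneg [Fintype 𝒳] {Q : 𝒳 × 𝒳 → ℝ} (hQ : ∀ w, 0 ≤ Q w)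
    (u : 𝒳) : 0 ≤ marginalFst Q u :=
  Finset.sum_nonneg fun v _ => hQ (u, v)

lemma marginalFst_mul_condProb [Fintype 𝒳] {Q : 𝒳 × 𝒳 → ℝ} (hQ : ∀ w, 0 ≤ Q w) (u v : 𝒳) :
    marginalFst Q u * condProb Q u v = Q (u, v) := by
  unfold condProb
  by_cases h : marginalFst Q u = 0
  · have := le_marginalFst hQ u v
    have := hQ (u, v)
    rw [h]; linarith [hQ (u, v)]
  · field_simp

lemma condEntropy_eq_sum [Fintype 𝒳] (d : ℕ) {Q : 𝒳 × 𝒳 → ℝ} (hQ : ∀ w, 0 ≤ Q w) :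
    condEntropy d (condProb Q) (marginalFst Q)
      = -∑ w : 𝒳 × 𝒳, Q w * Real.logb d (condProb Q w.1 w.2) := by
  rw [condEntropy, Fintype.sum_prod_type, Finset.sum_filter]
  congr 1
  refine Finset.sum_congr rfl fun u _ => ?_
  simp_rw [marginalFst_mul_condProb hQ]
  split_ifs with h
  · rfl
  · have h0 : ∀ v, Q (u, v) = 0 := fun v =>
      le_antisymm ((le_marginalFst hQ u v).trans (not_lt.mp h)) (hQ _)
    simp [h0]

lemma condProb_nonneg [Fintype 𝒳] {Q : 𝒳 × 𝒳 → ℝ} (hQ : ∀ w, 0 ≤ Q w)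
    (u v : 𝒳) : 0 ≤ condProb Q u v :=
  div_nonneg (hQ _) (marginalFst_nonneg hQ u)

/-- Only an inequality: a row of zero marginal sums to `0`, since division by zero gives `0`. -/
lemma sum_condProb_le_one [Fintype 𝒳] (Q : 𝒳 × 𝒳 → ℝ) (u : 𝒳) : ∑ v, condProb Q u v ≤ 1 := by
  unfold condProb
  rw [← Finset.sum_div]
  exact div_self_le_one _

lemma condProb_pairType_pos [Fintype 𝒳] [DecidableEq 𝒳] (hm : 0 < m) (x : Fin (m + 1) → 𝒳)
    (j : Fin m) :
    0 < condProb (pairType x) (x j.castSucc) (x j.succ) :=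
  div_pos (pairType_pos hm x j)
    ((pairType_pos hm x j).trans_le (le_marginalFst (pairType_nonneg x) _ _))

/-- The product of the values of `f` along the transitions of `x` is determined by its type. -/
lemma prod_transitions_eq_rpow [Fintype 𝒳] [DecidableEq 𝒳] {d : ℕ} (hd : 1 < d) (hm : 0 < m)
    (x : Fin (m + 1) → 𝒳)
    (f : 𝒳 × 𝒳 → ℝ) (hf : ∀ j : Fin m, 0 < f (x j.castSucc, x j.succ)) :
    ∏ j : Fin m, f (x j.castSucc, x j.succ)
      = (d : ℝ) ^ (m * ∑ w, pairType x w * Real.logb d (f w)) := by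
  have hd0 : (0 : ℝ) < d := by positivity
  have hd1 : (d : ℝ) ≠ 1 := by exact_mod_cast hd.ne'
  rw [sum_pairType_mul, mul_div_cancel₀ _ (by positivity), Real.rpow_sum_of_pos hd0]
  exact Finset.prod_congr rfl fun j _ => (Real.rpow_logb hd0 hd1 (hf j)).symm

/-- Under the chain fitted to its own type, a path has weight exactly `d^(-mH)`. This bounds the
size of a type class by `d^(mH)` up to a constant. -/
lemma prod_condProb_pairType [Fintype 𝒳] [DecidableEq 𝒳] {d : ℕ} (hd : 1 < d) (hm : 0 < m)
    (x : Fin (m + 1) → 𝒳) :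
    ∏ j : Fin m, condProb (pairType x) (x j.castSucc) (x j.succ)
      = (d : ℝ) ^ (-(m * typeEntropy d x)) := by
  rw [prod_transitions_eq_rpow hd hm x (fun w => condProb (pairType x) w.1 w.2)
    (condProb_pairType_pos hm x), typeEntropy, condEntropy_eq_sum d (pairType_nonneg x)]
  congr 1; ring

lemma sum_pathProd_succ [Fintype 𝒳] (f : 𝒳 → ℝ) (W : 𝒳 → 𝒳 → ℝ) (m : ℕ) :
    ∑ x : Fin (m + 2) → 𝒳, f (x 0) * ∏ j : Fin (m + 1), W (x j.castSucc) (x j.succ)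
      = ∑ x : Fin (m + 1) → 𝒳,
        (f (x 0) * ∏ j : Fin m, W (x j.castSucc) (x j.succ)) * ∑ v, W (x (Fin.last m)) v := by
  rw [← (Fin.snocEquiv (fun _ : Fin (m + 2) => 𝒳)).sum_comp, Fintype.sum_prod_type,
    Finset.sum_comm]
  refine Finset.sum_congr rfl fun x _ => ?_
  rw [Finset.mul_sum]
  refine Finset.sum_congr rfl fun v _ => ?_
  have h0 : (Fin.snocEquiv (fun _ : Fin (m + 2) => 𝒳)) (v, x) 0 = x 0 := by
    exact Fin.snoc_castSucc (α := fun _ => 𝒳) v x 0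
  have h1 : ∀ j : Fin (m + 1),
      (Fin.snocEquiv (fun _ : Fin (m + 2) => 𝒳)) (v, x) j.castSucc = x j :=
    fun j => Fin.snoc_castSucc (α := fun _ => 𝒳) v x j
  have h2 : (Fin.snocEquiv (fun _ : Fin (m + 2) => 𝒳)) (v, x) (Fin.last (m + 1)) = v :=
    Fin.snoc_last (α := fun _ => 𝒳) v x
  rw [Fin.prod_univ_castSucc]
  simp_rw [h0, h1, ← Fin.castSucc_succ, h1, Fin.succ_last, h2]
  ring

/-- Summing out the last letter never increases the total. No initial distribution is included, so
the free first letter costs a factor `|𝒳|`. -/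
lemma sum_pathProd_le [Fintype 𝒳] {W : 𝒳 → 𝒳 → ℝ} (hW : ∀ u v, 0 ≤ W u v)
    (hW1 : ∀ u, ∑ v, W u v ≤ 1)
    (m : ℕ) : ∑ x : Fin (m + 1) → 𝒳, ∏ j : Fin m, W (x j.castSucc) (x j.succ)
      ≤ Fintype.card 𝒳 := by
  induction m with
  | zero => simp
  | succ m ih =>
    refine le_trans ?_ ih
    have := sum_pathProd_succ (fun _ => 1) W m
    simp only [one_mul] at this
    rw [this]
    refine Finset.sum_le_sum fun x _ => ?_
    exact mul_le_of_le_one_right (Finset.prod_nonneg fun _ _ => hW _ _) (hW1 _)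

lemma markovDist_nonneg [Fintype 𝒳] {p : 𝒳 → ℝ} (hp : p ∈ stdSimplex ℝ 𝒳) {P : 𝒳 → 𝒳 → ℝ}
    (hP : ∀ u, P u ∈ stdSimplex ℝ 𝒳) (n : ℕ) (x : Fin n → 𝒳) : 0 ≤ markovDist p P n x := by
  cases n with
  | zero => simp [markovDist]
  | succ m => exact mul_nonneg (hp.1 _) (Finset.prod_nonneg fun _ _ => (hP _).1 _)

lemma sum_markovDist [Fintype 𝒳] {p : 𝒳 → ℝ} (hp : p ∈ stdSimplex ℝ 𝒳) {P : 𝒳 → 𝒳 → ℝ}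
    (hP : ∀ u, P u ∈ stdSimplex ℝ 𝒳) (n : ℕ) : ∑ x, markovDist p P n x = 1 := by
  cases n with
  | zero => simp [markovDist]
  | succ m =>
    simp only [markovDist]
    induction m with
    | zero =>
      simp only [Finset.univ_eq_empty, Finset.prod_empty, mul_one]
      rw [← (Equiv.funUnique (Fin 1) 𝒳).symm.sum_comp]
      simpa using hp.2
    | succ m ih =>
      rw [sum_pathProd_succ, ← ih]
      simp [(hP _).2]

/-- Every type contributes at most `|𝒳|` to the sum, and there are at most `(m+1)^(|𝒳|²)` types. -/
lemma sum_rpow_neg_typeEntropy_le [Fintype 𝒳] [DecidableEq 𝒳] {d : ℕ} (hd : 1 < d) (hm : 0 < m) :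
    ∑ x : Fin (m + 1) → 𝒳, (d : ℝ) ^ (-(m * typeEntropy d x))
      ≤ (m + 1) ^ Fintype.card (𝒳 × 𝒳) * Fintype.card 𝒳 := by
  let T : Finset (𝒳 × 𝒳 → ℕ) := Fintype.piFinset fun _ => Finset.range (m + 1)
  have hT : ∀ x ∈ (Finset.univ : Finset (Fin (m + 1) → 𝒳)), transitionCount x ∈ T := by
    intro x _
    simp only [T, Fintype.mem_piFinset, Finset.mem_range]
    exact fun w => Nat.lt_succ_of_le (transitionCount_le x w)
  rw [← Finset.sum_fiberwise_of_maps_to hT]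
  have hcard : (T.card : ℝ) = (m + 1) ^ Fintype.card (𝒳 × 𝒳) := by simp [T]
  rw [← hcard, ← nsmul_eq_mul]
  refine Finset.sum_le_card_nsmul _ _ _ fun c _ => ?_
  -- All paths in the fibre share the type `Q`, so their terms are path weights of one substochastic
  -- chain; extending the sum to all paths bounds it.
  let Q : 𝒳 × 𝒳 → ℝ := fun w => c w / m
  have hQ : ∀ w, 0 ≤ Q w := fun w => by positivity
  refine le_trans ?_ (sum_pathProd_le (condProb_nonneg hQ) (sum_condProb_le_one Q) m)
  have : ∀ x ∈ (Finset.univ : Finset (Fin (m + 1) → 𝒳)).filter (fun x => transitionCount x = c),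
      (d : ℝ) ^ (-(m * typeEntropy d x))
        = ∏ j : Fin m, condProb Q (x j.castSucc) (x j.succ) := by
    intro x hx
    have hxQ : pairType x = Q := by
      funext w
      simp only [pairType, Q, (Finset.mem_filter.mp hx).2]
    rw [← prod_condProb_pairType hd hm, hxQ]
  rw [Finset.sum_congr rfl this]
  exact Finset.sum_le_sum_of_subset_of_nonneg (Finset.subset_univ _)
    fun x _ _ => Finset.prod_nonneg fun _ _ => condProb_nonneg hQ _ _

end Types

/-! ### The exponent as a continuous real function -/

section Exponent

variable {𝒳 : Type*} [Fintype 𝒳]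

/-- The value of `exponentObjective` on the distributions absolutely continuous with respect
to `P`. -/
def realObjective (d : ℕ) (R : ℝ) (P : 𝒳 → 𝒳 → ℝ) (Q : 𝒳 × 𝒳 → ℝ) : ℝ :=
  -condEntropy d (condProb Q) (marginalFst Q) - ∑ w, Q w * Real.logb d (P w.1 w.2)
    + max (1 - condEntropy d (condProb Q) (marginalFst Q) - R) 0

/-- The distributions on `𝒳²` whose conditional distribution is absolutely continuous with
respect to `P`. -/
def supported (P : 𝒳 → 𝒳 → ℝ) : Set (𝒳 × 𝒳 → ℝ) :=
  {Q | Q ∈ stdSimplex ℝ (𝒳 × 𝒳) ∧ ∀ u v, P u v = 0 → Q (u, v) = 0}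

lemma isCompact_supported (P : 𝒳 → 𝒳 → ℝ) : IsCompact (supported P) := by
  refine (isCompact_stdSimplex ℝ (𝒳 × 𝒳)).inter_right ?_
  have : {Q : 𝒳 × 𝒳 → ℝ | ∀ u v, P u v = 0 → Q (u, v) = 0}
      = ⋂ (u) (v) (_ : P u v = 0), {Q | Q (u, v) = 0} := by
    ext Q; simp
  change IsClosed {Q : 𝒳 × 𝒳 → ℝ | ∀ u v, P u v = 0 → Q (u, v) = 0}
  rw [this]
  refine isClosed_iInter fun u => isClosed_iInter fun v => isClosed_iInter fun _ => ?_
  exact isClosed_eq (continuous_apply _) continuous_const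

lemma continuous_marginalFst (u : 𝒳) : Continuous fun Q : 𝒳 × 𝒳 → ℝ => marginalFst Q u := by
  unfold marginalFst; fun_prop

lemma continuous_marginalSnd (u : 𝒳) : Continuous fun Q : 𝒳 × 𝒳 → ℝ => marginalSnd Q u := by
  unfold marginalSnd; fun_prop

/-- The chain rule `H(V|U) = H(U,V) - H(U)`. It yields continuity even where a marginal vanishes and
the conditional probabilities themselves need not be continuous. -/
lemma condEntropy_eq_negMulLog (d : ℕ) {Q : 𝒳 × 𝒳 → ℝ} (hQ : ∀ w, 0 ≤ Q w) :
    condEntropy d (condProb Q) (marginalFst Q)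
      = (∑ w, Real.negMulLog (Q w) - ∑ u, Real.negMulLog (marginalFst Q u)) / Real.log d := by
  have h : ∀ u v, Q (u, v) * Real.logb d (condProb Q u v)
      = (Q (u, v) * Real.log (marginalFst Q u) + Real.negMulLog (Q (u, v))) * (-1 / Real.log d) := by
    intro u v
    rcases (hQ (u, v)).eq_or_lt with h0 | h0
    · simp [← h0]
    · have h1 : 0 < marginalFst Q u := h0.trans_le (le_marginalFst hQ u v)
      rw [condProb, Real.logb, Real.log_div h0.ne' h1.ne', Real.negMulLog]
      ring
  rw [condEntropy_eq_sum d hQ, Fintype.sum_prod_type, Fintype.sum_prod_type]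
  simp_rw [h, ← Finset.sum_mul, Finset.sum_add_distrib, ← Finset.sum_mul]
  simp only [Real.negMulLog, marginalFst, neg_mul, Finset.sum_neg_distrib]
  ring

lemma continuousOn_condEntropy (d : ℕ) : ContinuousOn
    (fun Q : 𝒳 × 𝒳 → ℝ => condEntropy d (condProb Q) (marginalFst Q)) {Q | ∀ w, 0 ≤ Q w} := by
  refine ContinuousOn.congr (Continuous.continuousOn ?_)
    fun Q hQ => condEntropy_eq_negMulLog d hQ
  refine Continuous.div_const (Continuous.sub ?_ ?_) _
  · exact continuous_finsetSum _ fun w _ => Real.continuous_negMulLog.comp (continuous_apply w)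
  · exact continuous_finsetSum _ fun u _ =>
      Real.continuous_negMulLog.comp (continuous_marginalFst u)

lemma continuousOn_realObjective (d : ℕ) (R : ℝ) (P : 𝒳 → 𝒳 → ℝ) :
    ContinuousOn (realObjective d R P) (supported P) := by
  have h := (continuousOn_condEntropy (𝒳 := 𝒳) d).mono
    (fun Q (hQ : Q ∈ supported P) => hQ.1.1)
  unfold realObjective
  refine ContinuousOn.add (ContinuousOn.sub h.neg (Continuous.continuousOn (by fun_prop))) ?_
  exact ((continuousOn_const.sub h).sub continuousOn_const).sup continuousOn_const

lemma coe_sum {ι : Type*} (s : Finset ι) (f : ι → ℝ) :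
    ((∑ i ∈ s, f i : ℝ) : EReal) = ∑ i ∈ s, (f i : EReal) :=
  map_sum (⟨⟨Real.toEReal, EReal.coe_zero⟩, EReal.coe_add⟩ : ℝ →+ EReal) f s

lemma divergence_eq_coe (d : ℕ) {P : 𝒳 → 𝒳 → ℝ} {Q : 𝒳 × 𝒳 → ℝ} (hQ : Q ∈ supported P) :
    divergence d Q P = ((-condEntropy d (condProb Q) (marginalFst Q)
      - ∑ w, Q w * Real.logb d (P w.1 w.2) : ℝ) : EReal) := by
  have hQ0 := hQ.1.1
  have h : ∀ u v, divergenceTerm d (Q (u, v)) (condProb Q u v) (P u v)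
      = ((Q (u, v) * Real.logb d (condProb Q u v) - Q (u, v) * Real.logb d (P u v) : ℝ)
        : EReal) := by
    intro u v
    unfold divergenceTerm
    split_ifs with h1 h2
    · simp [h1]
    · exact absurd (hQ.2 u v h2) h1
    · have h3 : 0 < Q (u, v) := lt_of_le_of_ne (hQ0 _) (Ne.symm h1)
      have h4 : 0 < marginalFst Q u := h3.trans_le (le_marginalFst hQ0 u v)
      rw [Real.logb_div (x := condProb Q u v) (div_pos h3 h4).ne' h2]
      congr 1; ring
  have h0 : ∀ u, ¬ 0 < marginalFst Q u → ∀ v, Q (u, v) = 0 := fun u hu v =>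
    le_antisymm ((le_marginalFst hQ0 u v).trans (not_lt.mp hu)) (hQ0 _)
  rw [divergence, Finset.sum_filter, condEntropy_eq_sum d hQ0, neg_neg, ← Finset.sum_sub_distrib,
    Fintype.sum_prod_type, coe_sum]
  refine Finset.sum_congr rfl fun u _ => ?_
  simp_rw [h, ← coe_sum]
  split_ifs with hu
  · rfl
  · simp [h0 u hu]

lemma exponentObjective_eq_coe (d : ℕ) (R : ℝ) {P : 𝒳 → 𝒳 → ℝ} {Q : 𝒳 × 𝒳 → ℝ}
    (hQ : Q ∈ supported P) : exponentObjective d R P Q = (realObjective d R P Q : EReal) := by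
  rw [exponentObjective, divergence_eq_coe d hQ, realObjective, EReal.coe_add]

lemma divergenceTerm_ne_bot (d : ℕ) (a b c : ℝ) : divergenceTerm d a b c ≠ ⊥ := by
  unfold divergenceTerm
  split_ifs
  · exact EReal.zero_ne_bot
  · exact top_ne_bot
  · exact EReal.coe_ne_bot _

lemma sum_ne_bot {ι : Type*} {s : Finset ι} {f : ι → EReal} (hf : ∀ i ∈ s, f i ≠ ⊥) :
    ∑ i ∈ s, f i ≠ ⊥ := by
  refine Finset.sum_induction f (· ≠ ⊥) (fun a b ha hb => ?_) (by simp) hf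
  simp [EReal.add_eq_bot_iff, ha, hb]

/-- In `EReal` the sum `⊤ + ⊥` is `⊥`, so an infinite term dominates only when no term is `⊥`. -/
lemma sum_eq_top {ι : Type*} {s : Finset ι} {f : ι → EReal} (hf : ∀ i ∈ s, f i ≠ ⊥) {i : ι}
    (hi : i ∈ s) (h : f i = ⊤) : ∑ i ∈ s, f i = ⊤ := by
  classical
  rw [← Finset.add_sum_erase s f hi, h]
  exact EReal.top_add_of_ne_bot (sum_ne_bot fun j hj => hf j (Finset.mem_of_mem_erase hj))

lemma exponentObjective_eq_top (d : ℕ) (R : ℝ) {P : 𝒳 → 𝒳 → ℝ} {Q : 𝒳 × 𝒳 → ℝ}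
    (hQ : Q ∈ stdSimplex ℝ (𝒳 × 𝒳)) (hQS : Q ∉ supported P) :
    exponentObjective d R P Q = ⊤ := by
  have : ∃ u v, P u v = 0 ∧ Q (u, v) ≠ 0 := by
    by_contra! h
    exact hQS ⟨hQ, h⟩
  obtain ⟨u, v, hP, hQuv⟩ := this
  have h3 : 0 < Q (u, v) := lt_of_le_of_ne (hQ.1 _) (Ne.symm hQuv)
  have h4 : 0 < marginalFst Q u := h3.trans_le (le_marginalFst hQ.1 u v)
  have hD : divergence d Q P = ⊤ := by
    refine sum_eq_top (fun u _ => sum_ne_bot fun v _ => divergenceTerm_ne_bot _ _ _ _)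
      (i := u) (by simpa using h4) ?_
    exact sum_eq_top (fun v _ => divergenceTerm_ne_bot _ _ _ _) (Finset.mem_univ v)
      (by simp [divergenceTerm, hP, hQuv])
  rw [exponentObjective, hD]
  exact EReal.top_add_of_ne_bot (by simp)

lemma balanced_nonempty [Nonempty 𝒳] : (balanced 𝒳).Nonempty := by
  refine ⟨fun _ => (Fintype.card (𝒳 × 𝒳) : ℝ)⁻¹, ⟨fun _ => by positivity, ?_⟩, rfl⟩
  rw [Finset.sum_const, Finset.card_univ, nsmul_eq_mul]
  exact mul_inv_cancel₀ (by positivity)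

lemma isClosed_balancedMarginals :
    IsClosed {Q : 𝒳 × 𝒳 → ℝ | marginalFst Q = marginalSnd Q} :=
  isClosed_eq (continuous_pi continuous_marginalFst) (continuous_pi continuous_marginalSnd)

/-- The minimum defining the exponent is attained. -/
lemma exists_isLeast_exponentObjective [Nonempty 𝒳] (d : ℕ) (R : ℝ) (P : 𝒳 → 𝒳 → ℝ) :
    ∃ E, IsLeast (exponentObjective d R P '' balanced 𝒳) E := by
  rcases (balanced 𝒳 ∩ supported P).eq_empty_or_nonempty with h | h
  · obtain ⟨Q₀, hQ₀⟩ := balanced_nonempty (𝒳 := 𝒳)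
    have htop : ∀ Q ∈ balanced 𝒳, exponentObjective d R P Q = ⊤ := fun Q hQ =>
      exponentObjective_eq_top d R hQ.1 fun hS => h.subset ⟨hQ, hS⟩
    refine ⟨⊤, ⟨Q₀, hQ₀, htop Q₀ hQ₀⟩, ?_⟩
    rintro _ ⟨Q, hQ, rfl⟩
    exact (htop Q hQ).ge
  · have hc : IsCompact (balanced 𝒳 ∩ supported P) := by
      have := (isCompact_supported P).inter_right (isClosed_balancedMarginals (𝒳 := 𝒳))
      convert this using 1
      ext Q
      simp only [balanced, supported, Set.mem_inter_iff, Set.mem_ofPred_eq]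
      tauto
    obtain ⟨Q₀, hQ₀, hmin⟩ := hc.exists_isMinOn h
      ((continuousOn_realObjective d R P).mono Set.inter_subset_right)
    refine ⟨_, ⟨Q₀, hQ₀.1, rfl⟩, ?_⟩
    rintro _ ⟨Q, hQ, rfl⟩
    by_cases hS : Q ∈ supported P
    · rw [exponentObjective_eq_coe d R hS, exponentObjective_eq_coe d R hQ₀.2]
      exact EReal.coe_le_coe_iff.mpr (hmin ⟨hQ, hS⟩)
    · rw [exponentObjective_eq_top d R hQ.1 hS]
      exact le_top

/-- Below the exponent, the objective stays large on distributions with nearly equal marginals. -/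
lemma exists_pos_lt_realObjective (d : ℕ) (R : ℝ) (P : 𝒳 → 𝒳 → ℝ) {e : ℝ}
    (he : ∀ Q ∈ balanced 𝒳, (e : EReal) < exponentObjective d R P Q) :
    ∃ δ > 0, ∀ Q ∈ supported P, (∀ u, |marginalFst Q u - marginalSnd Q u| < δ) →
      e < realObjective d R P Q := by
  -- On this compact sublevel set the distance between the marginals is positive, as no balanced
  -- point lies in it; its minimum there serves as `δ`.
  have hK : IsCompact (supported P ∩ realObjective d R P ⁻¹' Set.Iic e) :=
    (isCompact_supported P).of_isClosed_subset
      ((continuousOn_realObjective d R P).preimage_isClosed_of_isClosed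
        (isCompact_supported P).isClosed isClosed_Iic) Set.inter_subset_left
  rcases Set.eq_empty_or_nonempty (supported P ∩ realObjective d R P ⁻¹' Set.Iic e) with h | h
  · exact ⟨1, one_pos, fun Q hQ _ => not_le.mp fun hle => h.subset ⟨hQ, hle⟩⟩
  · have hcont : Continuous fun Q : 𝒳 × 𝒳 → ℝ => dist (marginalFst Q) (marginalSnd Q) :=
      (continuous_pi continuous_marginalFst).dist (continuous_pi continuous_marginalSnd)
    obtain ⟨Q₀, hQ₀, hmin⟩ := hK.exists_isMinOn h hcont.continuousOn
    have hpos : 0 < dist (marginalFst Q₀) (marginalSnd Q₀) := by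
      refine dist_pos.mpr fun heq => ?_
      have := he Q₀ ⟨hQ₀.1.1, heq⟩
      rw [exponentObjective_eq_coe d R hQ₀.1, EReal.coe_lt_coe_iff] at this
      exact absurd hQ₀.2 (not_le.mpr this)
    refine ⟨_, hpos, fun Q hQ hQδ => not_le.mp fun hle => ?_⟩
    have h1 : dist (marginalFst Q₀) (marginalSnd Q₀) ≤ dist (marginalFst Q) (marginalSnd Q) :=
      hmin ⟨hQ, hle⟩
    exact absurd ((dist_pi_lt_iff hpos).mpr fun u => by simpa [Real.dist_eq] using hQδ u)
      (not_lt.mpr h1)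

end Exponent

/-! ### Method of types for minimum entropy decoding -/

/-- The error bound of minimum entropy decoding. -/
lemma sum_markovDist_mul_min_le {𝒳 : Type*} [Fintype 𝒳] [DecidableEq 𝒳] {d m : ℕ} (hd : 1 < d)
    (hm : 0 < m) {p : 𝒳 → ℝ} (hp : p ∈ stdSimplex ℝ 𝒳) {P : 𝒳 → 𝒳 → ℝ}
    (hP : ∀ u, P u ∈ stdSimplex ℝ 𝒳) {R e a A : ℝ} (ha : 0 ≤ a) (hA : 1 ≤ A)
    (haA : a ≤ A * (d : ℝ) ^ (-(m * (1 - R))))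
    (he : ∀ x : Fin (m + 1) → 𝒳, pairType x ∈ supported P →
      e ≤ realObjective d R P (pairType x)) :
    ∑ x : Fin (m + 1) → 𝒳, markovDist p P (m + 1) x *
        min 1 (a * (Finset.univ.filter fun y : Fin (m + 1) → 𝒳 => typeEntropy d y ≤ typeEntropy d x).card)
      ≤ A * ((m + 1) ^ Fintype.card (𝒳 × 𝒳) * Fintype.card 𝒳) ^ 2 * (d : ℝ) ^ (-(m * e)) := by
  have hd0 : (0 : ℝ) < d := by positivity
  have hd1 : (1 : ℝ) ≤ d := by exact_mod_cast hd.le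
  set K : ℝ := (m + 1) ^ Fintype.card (𝒳 × 𝒳) * Fintype.card 𝒳 with hK
  have hN : ∀ x : Fin (m + 1) → 𝒳,
      ((Finset.univ.filter fun y : Fin (m + 1) → 𝒳 => typeEntropy d y ≤ typeEntropy d x).card : ℝ)
        ≤ K * (d : ℝ) ^ (m * typeEntropy d x) := by
    intro x
    calc ((Finset.univ.filter fun y : Fin (m + 1) → 𝒳 => typeEntropy d y ≤ typeEntropy d x).card : ℝ)
        = ∑ y : Fin (m + 1) → 𝒳 with typeEntropy d y ≤ typeEntropy d x, (1 : ℝ) := by simp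
      -- Each counted `y` has entropy at most that of `x`, so the inserted factor is at least `1`.
      _ ≤ ∑ y : Fin (m + 1) → 𝒳 with typeEntropy d y ≤ typeEntropy d x,
          (d : ℝ) ^ (-(m * typeEntropy d y)) * (d : ℝ) ^ (m * typeEntropy d x) := by
          refine Finset.sum_le_sum fun y hy => ?_
          rw [← Real.rpow_add hd0]
          refine Real.one_le_rpow hd1 ?_
          have := mul_le_mul_of_nonneg_left (Finset.mem_filter.mp hy).2 (Nat.cast_nonneg (α := ℝ) m)
          linarith
      _ ≤ ∑ y : Fin (m + 1) → 𝒳, (d : ℝ) ^ (-(m * typeEntropy d y)) * (d : ℝ) ^ (m * typeEntropy d x) :=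
          Finset.sum_le_sum_of_subset_of_nonneg (Finset.subset_univ _) fun y _ _ => by positivity
      _ ≤ K * (d : ℝ) ^ (m * typeEntropy d x) := by
          rw [← Finset.sum_mul]
          exact mul_le_mul_of_nonneg_right (sum_rpow_neg_typeEntropy_le hd hm) (by positivity)
  have hterm : ∀ x : Fin (m + 1) → 𝒳, markovDist p P (m + 1) x *
        min 1 (a * (Finset.univ.filter fun y : Fin (m + 1) → 𝒳 => typeEntropy d y ≤ typeEntropy d x).card)
      ≤ A * K * (d : ℝ) ^ (-(m * e)) * (d : ℝ) ^ (-(m * typeEntropy d x)) := by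
    intro x
    have hK1 : 1 ≤ K := by
      have h1 : (1 : ℝ) ≤ (m + 1) ^ Fintype.card (𝒳 × 𝒳) :=
        one_le_pow₀ (by linarith [Nat.cast_nonneg (α := ℝ) m])
      have h2 : (1 : ℝ) ≤ Fintype.card 𝒳 := by
        exact_mod_cast Fintype.card_pos_iff.mpr ⟨x 0⟩
      exact one_le_mul_of_one_le_of_one_le h1 h2
    have hAK : 1 ≤ A * K := one_le_mul_of_one_le_of_one_le hA hK1
    by_cases hx : ∀ j : Fin m, P (x j.castSucc) (x j.succ) ≠ 0
    swap
    · have h0 : markovDist p P (m + 1) x = 0 := by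
        push Not at hx
        obtain ⟨j, hj⟩ := hx
        exact mul_eq_zero_of_right _ (Finset.prod_eq_zero (Finset.mem_univ j) hj)
      rw [h0, zero_mul]
      positivity
    have hS : pairType x ∈ supported P := by
      refine ⟨pairType_mem_stdSimplex hm x, fun u v huv => ?_⟩
      have : transitionCount x (u, v) = 0 := by
        refine Finset.card_eq_zero.mpr (Finset.filter_eq_empty_iff.mpr fun j _ hj => ?_)
        obtain ⟨h1, h2⟩ := Prod.mk.inj hj
        exact hx j (by rw [h1, h2, huv])
      simp [pairType, this]
    have hprob : markovDist p P (m + 1) x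
        ≤ (d : ℝ) ^ (m * ∑ w, pairType x w * Real.logb d (P w.1 w.2)) := by
      rw [← prod_transitions_eq_rpow hd hm x (fun w => P w.1 w.2)
        (fun j => lt_of_le_of_ne ((hP _).1 _) (Ne.symm (hx j)))]
      refine mul_le_of_le_one_left (Finset.prod_nonneg fun _ _ => (hP _).1 _) ?_
      rw [← hp.2]
      exact Finset.single_le_sum (fun u _ => hp.1 u) (Finset.mem_univ _)
    have hmin : min 1 (a * (Finset.univ.filter fun y : Fin (m + 1) → 𝒳 =>
        typeEntropy d y ≤ typeEntropy d x).card)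
        ≤ A * K * (d : ℝ) ^ (-(m * max (1 - typeEntropy d x - R) 0)) := by
      rcases le_total (1 - typeEntropy d x - R) 0 with h | h
      · rw [max_eq_right h]
        refine (min_le_left _ _).trans ?_
        simpa using hAK
      · rw [max_eq_left h]
        refine (min_le_right _ _).trans ?_
        calc _ ≤ (A * (d : ℝ) ^ (-(m * (1 - R)))) * (K * (d : ℝ) ^ (m * typeEntropy d x)) :=
              mul_le_mul haA (hN x) (by positivity) (by positivity)
          _ = A * K * ((d : ℝ) ^ (-(m * (1 - R))) * (d : ℝ) ^ (m * typeEntropy d x)) := by ring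
          _ = _ := by
              rw [← Real.rpow_add hd0]
              congr 2; ring
    calc _ ≤ (d : ℝ) ^ (m * ∑ w, pairType x w * Real.logb d (P w.1 w.2)) *
          (A * K * (d : ℝ) ^ (-(m * max (1 - typeEntropy d x - R) 0))) :=
          mul_le_mul hprob hmin (le_min zero_le_one (by positivity)) (by positivity)
      _ = A * K * ((d : ℝ) ^ (m * ∑ w, pairType x w * Real.logb d (P w.1 w.2)) *
          (d : ℝ) ^ (-(m * max (1 - typeEntropy d x - R) 0))) := by ring
      -- The entropy left over beside `realObjective` gives the weight `d^(-mH)`, whose sum over all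
      -- sequences is polynomial.
      _ = A * K * ((d : ℝ) ^ (-(m * realObjective d R P (pairType x))) *
          (d : ℝ) ^ (-(m * typeEntropy d x))) := by
          rw [← Real.rpow_add hd0, ← Real.rpow_add hd0]
          congr 2
          rw [realObjective, typeEntropy]
          ring
      _ ≤ A * K * ((d : ℝ) ^ (-(m * e)) * (d : ℝ) ^ (-(m * typeEntropy d x))) := by
          gcongr
          exact he x hS
      _ = _ := by ring
  calc _ ≤ ∑ x : Fin (m + 1) → 𝒳,
        A * K * (d : ℝ) ^ (-(m * e)) * (d : ℝ) ^ (-(m * typeEntropy d x)) :=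
        Finset.sum_le_sum fun x _ => hterm x
    _ ≤ A * K * (d : ℝ) ^ (-(m * e)) * K := by
        rw [← Finset.mul_sum]
        refine mul_le_mul_of_nonneg_left (sum_rpow_neg_typeEntropy_le hd hm) ?_
        positivity
    _ = _ := by ring

/-! ### Kraus maps and fidelities -/

section Kraus

variable {ι κ τ : Type*} [Fintype ι] [Fintype κ] [Fintype τ]

lemma krausMap_apply (K : κ → Matrix ι ι ℂ) (ρ : Matrix ι ι ℂ) :
    krausMap K ρ = ∑ i, K i * ρ * (K i)ᴴ := rfl

lemma krausMap_comp (K : κ → Matrix ι ι ℂ) (L : τ → Matrix ι ι ℂ) :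
    krausMap K ∘ₗ krausMap L = krausMap fun q : κ × τ => K q.1 * L q.2 := by
  ext1 ρ
  simp only [LinearMap.comp_apply, krausMap_apply, Fintype.sum_prod_type]
  refine Finset.sum_congr rfl fun i _ => ?_
  simp only [Matrix.mul_sum, Matrix.sum_mul, conjTranspose_mul, Matrix.mul_assoc]

lemma posSemidef_krausMap (K : κ → Matrix ι ι ℂ) {ρ : Matrix ι ι ℂ} (hρ : ρ.PosSemidef) :
    (krausMap K ρ).PosSemidef :=
  Matrix.posSemidef_sum _ fun i _ => hρ.mul_mul_conjTranspose_same (K i)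

lemma trace_krausMap [DecidableEq ι] {K : κ → Matrix ι ι ℂ} (hK : ∑ i, (K i)ᴴ * K i = 1)
    (ρ : Matrix ι ι ℂ) : (krausMap K ρ).trace = ρ.trace := by
  rw [krausMap_apply, Matrix.trace_sum]
  have : ∀ i, (K i * ρ * (K i)ᴴ).trace = ((K i)ᴴ * K i * ρ).trace := fun i => by
    rw [Matrix.trace_mul_comm, Matrix.mul_assoc]
  simp_rw [this]
  rw [← Matrix.trace_sum, ← Matrix.sum_mul, hK, Matrix.one_mul]

/-- Ampliation stays in Kraus form, with operators `1 ⊗ K i`, so complete positivity reduces to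
positivity. -/
lemma ampliation_krausMap (k : ℕ) (K : κ → Matrix ι ι ℂ)
    (ρ : Matrix (Fin k × ι) (Fin k × ι) ℂ) :
    ampliation k (krausMap K) ρ
      = krausMap (fun i => kronecker (1 : Matrix (Fin k) (Fin k) ℂ) (K i)) ρ := by
  ext ⟨a, i⟩ ⟨b, j⟩
  simp [ampliation, krausMap_apply, Matrix.sum_apply, Matrix.mul_apply, Fintype.sum_prod_type,
    Matrix.one_apply, conjTranspose_apply, kroneckerMap_apply, apply_ite star, ite_mul, mul_ite]

lemma isTPCP_krausMap [DecidableEq ι] {K : κ → Matrix ι ι ℂ} (hK : ∑ i, (K i)ᴴ * K i = 1) :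
    IsTPCP (krausMap K) :=
  ⟨trace_krausMap hK, fun k ρ hρ => by
    rw [ampliation_krausMap]; exact posSemidef_krausMap _ hρ⟩

lemma IsTPCP.posSemidef {Φ : Matrix ι ι ℂ →ₗ[ℂ] Matrix ι ι ℂ} (hΦ : IsTPCP Φ)
    {ρ : Matrix ι ι ℂ} (hρ : ρ.PosSemidef) : (Φ ρ).PosSemidef := by
  have h := hΦ.completely_positive 1 (ρ.submatrix Prod.snd Prod.snd) (hρ.submatrix _)
  exact h.submatrix (fun i : ι => ((0 : Fin 1), i))

/-- The missing part of the trace is that of the compression of `ρ` by `1 - |ψ⟩⟨ψ|`, which is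
positive semidefinite. -/
lemma dotProduct_mulVec_le_trace [DecidableEq ι] {ρ : Matrix ι ι ℂ} (hρ : ρ.PosSemidef)
    {ψ : ι → ℂ} (hψ : star ψ ⬝ᵥ ψ = 1) : star ψ ⬝ᵥ (ρ *ᵥ ψ) ≤ ρ.trace := by
  set q : Matrix ι ι ℂ := vecMulVec ψ (star ψ)
  have hq : qᴴ = q := by simp [q, conjTranspose_vecMulVec]
  have hqq : q * q = q := by
    simp [q, vecMulVec_mul_vecMulVec, hψ]
  have h := (hρ.mul_mul_conjTranspose_same (1 - q)).trace_nonneg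
  have h1 : (1 - q)ᴴ * (1 - q) = 1 - q := by
    rw [conjTranspose_sub, conjTranspose_one, hq]
    noncomm_ring [hqq]
  rw [Matrix.mul_assoc, Matrix.trace_mul_comm, Matrix.mul_assoc, h1, Matrix.mul_sub, Matrix.mul_one,
    Matrix.trace_sub, sub_nonneg] at h
  refine le_trans (le_of_eq ?_) h
  rw [Matrix.mul_vecMulVec, Matrix.trace_vecMulVec, dotProduct_comm]

lemma posSemidef_vecMulVec_star (ψ : ι → ℂ) : (vecMulVec ψ (star ψ)).PosSemidef :=
  posSemidef_vecMulVec_self_star ψ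

lemma fidelity_nonneg {Φ : Matrix ι ι ℂ →ₗ[ℂ] Matrix ι ι ℂ}
    (hΦ : ∀ ρ : Matrix ι ι ℂ, ρ.PosSemidef → (Φ ρ).PosSemidef) (ψ : ι → ℂ) : 0 ≤ fidelity Φ ψ :=
  (Complex.le_def.mp ((hΦ _ (posSemidef_vecMulVec_star ψ)).dotProduct_mulVec_nonneg ψ)).1

lemma fidelity_le_one [DecidableEq ι] {Φ : Matrix ι ι ℂ →ₗ[ℂ] Matrix ι ι ℂ}
    (hΦ : ∀ ρ : Matrix ι ι ℂ, ρ.PosSemidef → (Φ ρ).PosSemidef)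
    (hΦt : ∀ ρ, (Φ ρ).trace = ρ.trace) {ψ : ι → ℂ} (hψ : star ψ ⬝ᵥ ψ = 1) :
    fidelity Φ ψ ≤ 1 := by
  have h := dotProduct_mulVec_le_trace (hΦ _ (posSemidef_vecMulVec_star ψ)) hψ
  rw [hΦt, Matrix.trace_vecMulVec, dotProduct_comm ψ, hψ] at h
  exact (Complex.le_def.mp h).1

lemma fidelity_krausMap (K : κ → Matrix ι ι ℂ) (ψ : ι → ℂ) :
    fidelity (krausMap K) ψ = ∑ i, Complex.normSq (star ψ ⬝ᵥ (K i *ᵥ ψ)) := by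
  rw [fidelity, krausMap_apply, Matrix.sum_mulVec, dotProduct_sum, Complex.re_sum]
  refine Finset.sum_congr rfl fun i _ => ?_
  have h : star ψ ⬝ᵥ ((K i * vecMulVec ψ (star ψ) * (K i)ᴴ) *ᵥ ψ)
      = (star ψ ⬝ᵥ (K i *ᵥ ψ)) * star (star ψ ⬝ᵥ (K i *ᵥ ψ)) := by
    rw [Matrix.mul_vecMulVec, Matrix.vecMulVec_mul, vecMulVec_mulVec, dotProduct_smul]
    have : (star ψ ᵥ* (K i)ᴴ) ⬝ᵥ ψ = star (star ψ ⬝ᵥ (K i *ᵥ ψ)) := by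
      rw [← star_mulVec, ← star_dotProduct]
    rw [this]
    simp
  rw [h]
  change ((star ψ ⬝ᵥ (K i *ᵥ ψ)) * (starRingEnd ℂ) _).re = _
  rw [Complex.mul_conj, Complex.ofReal_re]

lemma exists_unit_mem {C : Submodule ℂ (ι → ℂ)} (hC : C ≠ ⊥) : ∃ ψ ∈ C, star ψ ⬝ᵥ ψ = 1 := by
  obtain ⟨φ, hφ, h0⟩ := Submodule.exists_mem_ne_zero_of_ne_bot hC
  have hpos : 0 < star φ ⬝ᵥ φ := dotProduct_star_self_pos_iff.mpr h0
  obtain ⟨hre, him⟩ := Complex.lt_def.mp hpos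
  set r : ℝ := (star φ ⬝ᵥ φ).re
  have hr : star φ ⬝ᵥ φ = (r : ℂ) := Complex.ext rfl (by simpa using him.symm)
  have hr0 : 0 < r := hre
  refine ⟨((√r)⁻¹ : ℂ) • φ, C.smul_mem _ hφ, ?_⟩
  rw [star_smul, smul_dotProduct, dotProduct_smul, hr]
  have : (√r : ℂ) * (√r : ℂ) = (r : ℂ) := by
    rw [← Complex.ofReal_mul, Real.mul_self_sqrt hr0.le]
  have h2 : (√r : ℂ) ≠ 0 := by
    exact_mod_cast (Real.sqrt_pos.mpr hr0).ne'
  simp only [smul_eq_mul, star_inv₀, RCLike.star_def, Complex.conj_ofReal]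
  field_simp
  rw [pow_two, this]

variable [DecidableEq ι]

lemma minFidelity_mem_Icc {C : Submodule ℂ (ι → ℂ)} (hC : C ≠ ⊥)
    {Φ : Matrix ι ι ℂ →ₗ[ℂ] Matrix ι ι ℂ}
    (hΦ : ∀ ρ : Matrix ι ι ℂ, ρ.PosSemidef → (Φ ρ).PosSemidef)
    (hΦt : ∀ ρ, (Φ ρ).trace = ρ.trace) : minFidelity C Φ ∈ Set.Icc 0 1 := by
  obtain ⟨ψ, hψ, hψ1⟩ := exists_unit_mem hC
  constructor
  · refine Real.sInf_nonneg ?_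
    rintro _ ⟨φ, -, rfl⟩
    exact fidelity_nonneg hΦ φ
  · refine le_trans ?_ (fidelity_le_one hΦ hΦt hψ1)
    refine csInf_le ⟨0, ?_⟩ ⟨ψ, ⟨hψ, hψ1⟩, rfl⟩
    rintro _ ⟨φ, -, rfl⟩
    exact fidelity_nonneg hΦ φ

/-- The set of minimum fidelities of all codes is bounded by `1`. -/
lemma minFidelity_comp_mem_Icc {K : κ → Matrix ι ι ℂ} (hK : ∑ i, (K i)ᴴ * K i = 1)
    {C : Submodule ℂ (ι → ℂ)} (hC : C ≠ ⊥) {𝓡 : Matrix ι ι ℂ →ₗ[ℂ] Matrix ι ι ℂ}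
    (h𝓡 : IsTPCP 𝓡) : minFidelity C (𝓡 ∘ₗ krausMap K) ∈ Set.Icc 0 1 :=
  minFidelity_mem_Icc hC (fun _ hρ => h𝓡.posSemidef (posSemidef_krausMap K hρ))
    fun ρ => (h𝓡.trace_preserving _).trans (trace_krausMap hK ρ)

lemma bestFidelity_le_one {K : κ → Matrix ι ι ℂ} (hK : ∑ i, (K i)ᴴ * K i = 1) (d : ℕ) (k : ℝ) :
    bestFidelity d k (krausMap K) ≤ 1 := by
  refine Real.sSup_le ?_ zero_le_one
  rintro _ ⟨C, 𝓡, hC, -, h𝓡, rfl⟩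
  exact (minFidelity_comp_mem_Icc hK hC h𝓡).2

lemma le_bestFidelity {K : κ → Matrix ι ι ℂ} (hK : ∑ i, (K i)ᴴ * K i = 1) {d : ℕ} {k f : ℝ}
    {C : Submodule ℂ (ι → ℂ)} (hC : C ≠ ⊥) (hk : k ≤ Real.logb d (Module.finrank ℂ C))
    {𝓡 : Matrix ι ι ℂ →ₗ[ℂ] Matrix ι ι ℂ} (h𝓡 : IsTPCP 𝓡)
    (hf : ∀ ψ ∈ C, star ψ ⬝ᵥ ψ = 1 → f ≤ fidelity (𝓡 ∘ₗ krausMap K) ψ) :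
    f ≤ bestFidelity d k (krausMap K) := by
  have h1 : f ≤ minFidelity C (𝓡 ∘ₗ krausMap K) := by
    obtain ⟨ψ, hψ, hψ1⟩ := exists_unit_mem hC
    refine le_csInf ⟨_, ψ, ⟨hψ, hψ1⟩, rfl⟩ ?_
    rintro _ ⟨φ, ⟨hφ, hφ1⟩, rfl⟩
    exact hf φ hφ hφ1
  refine h1.trans (le_csSup ⟨1, ?_⟩ ⟨C, 𝓡, hC, hk, h𝓡, rfl⟩)
  rintro _ ⟨C', 𝓡', hC', -, h𝓡', rfl⟩
  exact (minFidelity_comp_mem_Icc hK hC' h𝓡').2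

end Kraus

/-! ### Algebra of Weyl operators -/

section Weyl

variable {d : ℕ} [NeZero d] {ω : ℂ}

/-- The additive character `j ↦ ω ^ j`. -/
abbrev rootChar (hω : IsPrimitiveRoot ω d) : AddChar (ZMod d) ℂ :=
  AddChar.zmodChar d hω.pow_eq_one

lemma norm_rootChar (hω : IsPrimitiveRoot ω d) (t : ZMod d) : ‖rootChar hω t‖ = 1 := by
  rw [AddChar.zmodChar_apply, norm_pow, Complex.norm_eq_one_of_pow_eq_one hω.pow_eq_one (NeZero.ne d),
    one_pow]

lemma star_rootChar (hω : IsPrimitiveRoot ω d) (t : ZMod d) :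
    star (rootChar hω t) = rootChar hω (-t) := by
  rw [AddChar.map_neg_eq_inv, Complex.inv_eq_conj (norm_rootChar hω t)]
  rfl

lemma rootChar_injective (hω : IsPrimitiveRoot ω d) : Function.Injective (rootChar hω) := by
  intro s t h
  rw [AddChar.zmodChar_apply, AddChar.zmodChar_apply] at h
  exact ZMod.val_injective d (hω.pow_inj (ZMod.val_lt s) (ZMod.val_lt t) h)

lemma weylX_pow (k : ℕ) :
    weylX d ^ k = Matrix.of fun i j => if i = j - (k : ZMod d) then (1 : ℂ) else 0 := by
  induction k with
  | zero => ext i j; simp [Matrix.one_apply]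
  | succ k ih =>
    ext i j
    rw [pow_succ, ih, weylX, Matrix.mul_apply]
    simp [sub_sub, add_comm]

lemma weylN_apply (hω : IsPrimitiveRoot ω d) (u : Alphabet d) (a b : ZMod d) :
    weylN ω u a b = if a = b - u.1 then rootChar hω (u.2 * b) else 0 := by
  rw [weylN, weylX_pow, weylZ, Matrix.diagonal_pow, Matrix.mul_diagonal]
  simp only [Matrix.of_apply, ZMod.natCast_val, ZMod.cast_id', id_eq, ite_mul, one_mul, zero_mul]
  congr 1
  rw [AddChar.zmodChar_apply, Pi.pow_apply, ZMod.val_mul, ← pow_eq_pow_mod _ hω.pow_eq_one, ← pow_mul,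
    mul_comm]

variable {n : ℕ}

/-- The bilinear form `x₂ · y₁`, where `x = (x₁, x₂)` and `y = (y₁, y₂)`. -/
def crossForm (x y : Fin n → Alphabet d) : ZMod d := ∑ i, (x i).2 * (y i).1

/-- The symplectic form `x₁ · y₂ - x₂ · y₁`. -/
def symplecticForm (x y : Fin n → Alphabet d) : ZMod d := crossForm y x - crossForm x y

lemma rootChar_sum (hω : IsPrimitiveRoot ω d) (f : Fin n → ZMod d) :
    rootChar hω (∑ i, f i) = ∏ i, rootChar hω (f i) :=
  map_prod (rootChar hω).toMonoidHom (fun i => Multiplicative.ofAdd (f i)) Finset.univ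

lemma weylTensor_apply (hω : IsPrimitiveRoot ω d) (x : Fin n → Alphabet d)
    (a b : Fin n → ZMod d) : weylTensor ω x a b
      = if a = b - (fun i => (x i).1) then rootChar hω (∑ i, (x i).2 * b i) else 0 := by
  rw [weylTensor, Matrix.of_apply]
  simp_rw [weylN_apply hω]
  rw [Finset.prod_ite_zero, rootChar_sum]
  simp [funext_iff]

/-- The phase comes from moving the `Z` part of `x` past the `X` part of `y`. -/
lemma weylTensor_mul (hω : IsPrimitiveRoot ω d) (x y : Fin n → Alphabet d) :
    weylTensor ω x * weylTensor ω y
      = rootChar hω (-crossForm x y) • weylTensor ω (x + y) := by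
  ext a b
  rw [Matrix.mul_apply, Matrix.smul_apply]
  simp_rw [weylTensor_apply hω]
  simp only [mul_ite, mul_zero, Finset.sum_ite_eq', Finset.mem_univ, if_true, ite_mul, zero_mul,
    smul_eq_mul]
  have h1 : (a = b - (fun i => (y i).1) - fun i => (x i).1)
      ↔ (a = b - fun i => ((x + y) i).1) := by
    rw [sub_sub]
    have : (fun i => ((x + y) i).1) = (fun i => (y i).1) + fun i => (x i).1 := by
      funext i; simp [add_comm]
    rw [this]
  simp only [h1]
  congr 1
  rw [← AddChar.map_add_eq_mul, ← AddChar.map_add_eq_mul]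
  congr 1
  simp only [crossForm, Pi.sub_apply, Pi.add_apply, Prod.snd_add, mul_sub, add_mul,
    Finset.sum_sub_distrib, Finset.sum_add_distrib]
  ring

lemma weylTensor_zero (hω : IsPrimitiveRoot ω d) :
    weylTensor ω (0 : Fin n → Alphabet d) = 1 := by
  ext a b
  have : (fun i => ((0 : Fin n → Alphabet d) i).1) = 0 := rfl
  rw [weylTensor_apply hω, this]
  simp [Matrix.one_apply]

lemma weylTensor_commute (hω : IsPrimitiveRoot ω d) (x y : Fin n → Alphabet d) :
    weylTensor ω x * weylTensor ω y
      = rootChar hω (symplecticForm x y) • (weylTensor ω y * weylTensor ω x) := by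
  rw [weylTensor_mul hω, weylTensor_mul hω, smul_smul, ← AddChar.map_add_eq_mul, add_comm y x]
  congr 2
  rw [symplecticForm]
  ring

lemma conjTranspose_weylTensor_mul_self (hω : IsPrimitiveRoot ω d) (x : Fin n → Alphabet d) :
    (weylTensor ω x)ᴴ * weylTensor ω x = 1 := by
  ext a b
  rw [Matrix.mul_apply]
  simp_rw [conjTranspose_apply, weylTensor_apply hω, Matrix.one_apply]
  simp only [mul_ite, mul_zero, Finset.sum_ite_eq', Finset.mem_univ, if_true, apply_ite star,
    star_zero, ite_mul, zero_mul, sub_left_inj]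
  by_cases h : a = b
  · subst h
    simp [star_rootChar, ← AddChar.map_add_eq_mul]
  · simp [h, Ne.symm h]

lemma weylTensor_pow (hω : IsPrimitiveRoot ω d) (x : Fin n → Alphabet d) (k : ℕ) :
    ∃ c : ℂ, weylTensor ω x ^ k = c • weylTensor ω (k • x) := by
  induction k with
  | zero => exact ⟨1, by simp [weylTensor_zero hω]⟩
  | succ k ih =>
    obtain ⟨c, hc⟩ := ih
    refine ⟨c * rootChar hω (-crossForm (k • x) x), ?_⟩
    rw [pow_succ, hc, Matrix.smul_mul, weylTensor_mul hω, smul_smul, succ_nsmul]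

/-- The scalar need not be `1`: for `d = 2`, `(XZ)² = -1`. -/
lemma weylTensor_pow_card (hω : IsPrimitiveRoot ω d) (x : Fin n → Alphabet d) :
    ∃ c : ℂ, weylTensor ω x ^ d = c • (1 : Matrix (Fin n → ZMod d) (Fin n → ZMod d) ℂ) := by
  obtain ⟨c, hc⟩ := weylTensor_pow hω x d
  refine ⟨c, ?_⟩
  have : d • x = 0 := by
    funext i
    ext <;> simp
  rw [hc, this, weylTensor_zero hω]

/-- The Kraus operators of a mixture of Weyl unitaries are normalized. -/
lemma sum_weylKraus (hω : IsPrimitiveRoot ω d) {p : (Fin n → Alphabet d) → ℝ}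
    (hp : ∀ x, 0 ≤ p x) (hp1 : ∑ x, p x = 1) :
    ∑ x, ((√(p x) : ℂ) • weylTensor ω x)ᴴ * ((√(p x) : ℂ) • weylTensor ω x) = 1 := by
  have : ∀ x, ((√(p x) : ℂ) • weylTensor ω x)ᴴ * ((√(p x) : ℂ) • weylTensor ω x)
      = (p x : ℂ) • (1 : Matrix (Fin n → ZMod d) (Fin n → ZMod d) ℂ) := by
    intro x
    rw [conjTranspose_smul, Matrix.smul_mul, Matrix.mul_smul, conjTranspose_weylTensor_mul_self hω,
      smul_smul, RCLike.star_def, Complex.conj_ofReal, ← Complex.ofReal_mul,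
      Real.mul_self_sqrt (hp x)]
  simp_rw [this, ← Finset.sum_smul, ← Complex.ofReal_sum, hp1]
  simp

end Weyl

/-! ### Joint eigenprojections of commuting unitaries of finite order -/

section Projections

variable {ι : Type*} [Fintype ι] [DecidableEq ι] {d : ℕ} [Fact d.Prime] {ω : ℂ}

lemma conjTranspose_pow_mul_pow {V : Matrix ι ι ℂ} (hV : Vᴴ * V = 1) (k : ℕ) :
    (V ^ k)ᴴ * V ^ k = 1 := by
  rw [conjTranspose_pow]
  induction k with
  | zero => simp
  | succ k ih =>
    rw [pow_succ, pow_succ', Matrix.mul_assoc, ← Matrix.mul_assoc Vᴴ, hV, Matrix.one_mul, ih]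

lemma pow_val_add {M : Type*} [Monoid M] {V : M} (hV : V ^ d = 1) (s t : ZMod d) :
    V ^ (s + t).val = V ^ s.val * V ^ t.val := by
  rw [ZMod.val_add, ← pow_eq_pow_mod _ hV, pow_add]

/-- The spectral projection of a unitary `V` with `V ^ d = 1` for the eigenvalue `ω ^ s`. -/
def eigenProj (hω : IsPrimitiveRoot ω d) (V : Matrix ι ι ℂ) (s : ZMod d) : Matrix ι ι ℂ :=
  (d : ℂ)⁻¹ • ∑ t : ZMod d, rootChar hω (-(s * t)) • V ^ t.val

lemma commute_eigenProj (hω : IsPrimitiveRoot ω d) {A V : Matrix ι ι ℂ} (h : Commute A V)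
    (s : ZMod d) : Commute A (eigenProj hω V s) :=
  (Commute.sum_right _ _ _ fun t _ => (h.pow_right t.val).smul_right _).smul_right _

/-- Multiplication by `V ^ r` shifts the summation index of the Fourier sum. -/
lemma pow_mul_eigenProj (hω : IsPrimitiveRoot ω d) {V : Matrix ι ι ℂ} (hV : V ^ d = 1)
    (r s : ZMod d) : V ^ r.val * eigenProj hω V s = rootChar hω (s * r) • eigenProj hω V s := by
  rw [eigenProj, Matrix.mul_smul, Matrix.mul_sum, smul_comm (rootChar hω (s * r))]
  congr 1
  rw [Finset.smul_sum, ← Equiv.sum_comp (Equiv.addLeft r)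
    (fun t => rootChar hω (s * r) • rootChar hω (-(s * t)) • V ^ t.val)]
  refine Finset.sum_congr rfl fun t _ => ?_
  rw [Matrix.mul_smul, ← pow_val_add hV, smul_smul, ← AddChar.map_add_eq_mul, Equiv.coe_addLeft]
  congr 2
  ring

lemma eigenProj_mul_self (hω : IsPrimitiveRoot ω d) {V : Matrix ι ι ℂ} (hV : V ^ d = 1)
    (s : ZMod d) : eigenProj hω V s * eigenProj hω V s = eigenProj hω V s := by
  have hd : (d : ℂ) ≠ 0 := Nat.cast_ne_zero.mpr (NeZero.ne d)
  nth_rw 1 [eigenProj]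
  rw [Matrix.smul_mul, Matrix.sum_mul]
  have : ∀ t : ZMod d, rootChar hω (-(s * t)) • V ^ t.val * eigenProj hω V s
      = eigenProj hω V s := by
    intro t
    rw [Matrix.smul_mul, pow_mul_eigenProj hω hV, smul_smul, ← AddChar.map_add_eq_mul]
    simp
  simp_rw [this]
  rw [Finset.sum_const, Finset.card_univ, ZMod.card, ← Nat.cast_smul_eq_nsmul ℂ, smul_smul,
    inv_mul_cancel₀ hd, one_smul]

lemma conjTranspose_eigenProj (hω : IsPrimitiveRoot ω d) {V : Matrix ι ι ℂ} (hV : V ^ d = 1)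
    (hVu : Vᴴ * V = 1) (s : ZMod d) : (eigenProj hω V s)ᴴ = eigenProj hω V s := by
  have h1 : ∀ t : ZMod d, (V ^ t.val)ᴴ = V ^ (-t).val := by
    intro t
    have h3 : V ^ (-t).val * V ^ t.val = 1 := by
      rw [← pow_val_add hV]; simp
    exact Matrix.left_inv_eq_left_inv (conjTranspose_pow_mul_pow hVu _) h3
  rw [eigenProj, conjTranspose_smul, conjTranspose_sum]
  congr 1
  · simp
  · rw [← Equiv.sum_comp (Equiv.neg (ZMod d))]
    refine Finset.sum_congr rfl fun t _ => ?_
    rw [conjTranspose_smul, h1, star_rootChar, Equiv.neg_apply]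
    simp

/-- Orthogonality of characters leaves only the term `t = 0`. -/
lemma sum_eigenProj (hω : IsPrimitiveRoot ω d) (V : Matrix ι ι ℂ) :
    ∑ s, eigenProj hω V s = 1 := by
  have hd : (d : ℂ) ≠ 0 := Nat.cast_ne_zero.mpr (NeZero.ne d)
  unfold eigenProj
  rw [← Finset.smul_sum, Finset.sum_comm]
  have h : ∀ t : ZMod d, ∑ s : ZMod d, rootChar hω (-(s * t)) • V ^ t.val
      = if t = 0 then (d : ℂ) • (1 : Matrix ι ι ℂ) else 0 := by
    intro t
    have h1 := AddChar.sum_mulShift (-t) (AddChar.zmodChar_primitive_of_primitive_root d hω)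
    simp_rw [← Finset.sum_smul, ← mul_neg]
    rw [h1, ZMod.card]
    by_cases ht : t = 0
    · simp [ht]
    · simp [ht]
  simp_rw [h]
  simp [smul_smul, hd]

/-- Dividing `U` by a `d`-th root `l` of the scalar, of modulus `1` by unitarity, gives a unitary
with `V ^ d = 1`. The commutation clause lets projections of different unitaries be multiplied. -/
lemma exists_eigenProjections [Nonempty ι] (hω : IsPrimitiveRoot ω d) {U : Matrix ι ι ℂ}
    (hU : Uᴴ * U = 1) (hc : ∃ c : ℂ, U ^ d = c • (1 : Matrix ι ι ℂ)) :
    ∃ (E : ZMod d → Matrix ι ι ℂ) (l : ℂ), l ≠ 0 ∧ (∀ s, (E s)ᴴ = E s) ∧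
      (∀ s, E s * E s = E s) ∧ ∑ s, E s = 1 ∧ (∀ s, U * E s = (l * rootChar hω s) • E s) ∧
      ∀ A, Commute A U → ∀ s, Commute A (E s) := by
  obtain ⟨c, hc⟩ := hc
  have hd : 0 < d := NeZero.pos d
  obtain ⟨l, hl⟩ := IsAlgClosed.exists_pow_nat_eq c hd
  have hcn : star c * c = 1 := by
    have h := conjTranspose_pow_mul_pow hU d
    rw [hc, conjTranspose_smul, conjTranspose_one, Matrix.smul_mul, Matrix.mul_smul, smul_smul,
      Matrix.one_mul] at h
    obtain ⟨i⟩ := ‹Nonempty ι›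
    simpa using congrFun (congrFun h i) i
  have hln : ‖l‖ = 1 := by
    have h1 : ‖c‖ * ‖c‖ = 1 := by
      have := congrArg norm hcn
      simpa using this
    have h2 : ‖c‖ = 1 := by nlinarith [norm_nonneg c]
    rw [← hl, norm_pow] at h2
    exact (pow_eq_one_iff_of_nonneg (norm_nonneg l) hd.ne').mp h2
  have hl0 : l ≠ 0 := by
    intro h; simp [h] at hln
  have hlstar : star l * l = 1 := by
    rw [RCLike.star_def, Complex.conj_mul', hln]; simp
  set V : Matrix ι ι ℂ := l⁻¹ • U with hVdef
  have hUV : U = l • V := by rw [hVdef, smul_smul, mul_inv_cancel₀ hl0, one_smul]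
  have hV : V ^ d = 1 := by
    rw [hVdef, smul_pow, hc, smul_smul, inv_pow, hl, inv_mul_cancel₀, one_smul]
    rw [← hl]; exact pow_ne_zero _ hl0
  have hVu : Vᴴ * V = 1 := by
    rw [hVdef, conjTranspose_smul, Matrix.smul_mul, Matrix.mul_smul, smul_smul, hU, star_inv₀,
      ← mul_inv, hlstar, inv_one, one_smul]
  refine ⟨eigenProj hω V, l, hl0, conjTranspose_eigenProj hω hV hVu, eigenProj_mul_self hω hV,
    sum_eigenProj hω V, fun s => ?_, fun A hA s => commute_eigenProj hω (hA.smul_right _) s⟩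
  have h1 := pow_mul_eigenProj hω hV 1 s
  rw [ZMod.val_one d, pow_one, mul_one] at h1
  rw [hUV, Matrix.smul_mul, h1, smul_smul]

/-- Commuting unitaries whose `d`-th powers are scalar have a joint spectral resolution. -/
lemma exists_jointProjections [Nonempty ι] (hω : IsPrimitiveRoot ω d) {m : ℕ}
    (U : Fin m → Matrix ι ι ℂ) (hcomm : ∀ i j, Commute (U i) (U j))
    (hU : ∀ i, (U i)ᴴ * U i = 1) (hc : ∀ i, ∃ c : ℂ, U i ^ d = c • (1 : Matrix ι ι ℂ)) :
    ∃ (E : (Fin m → ZMod d) → Matrix ι ι ℂ) (l : Fin m → ℂ), (∀ i, l i ≠ 0) ∧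
      (∀ s, (E s)ᴴ = E s) ∧ (∀ s, E s * E s = E s) ∧ ∑ s, E s = 1 ∧
      (∀ s i, U i * E s = (l i * rootChar hω (s i)) • E s) ∧
      ∀ A, (∀ i, Commute A (U i)) → ∀ s, Commute A (E s) := by
  induction m with
  | zero =>
    exact ⟨fun _ => 1, fun i => i.elim0, fun i => i.elim0, fun _ => by simp, fun _ => by simp,
      by simp, fun _ i => i.elim0, fun A _ _ => Commute.one_right A⟩
  | succ m ih =>
    obtain ⟨E', l', hl', hEh', hEi', hEs', hEU', hEc'⟩ := ih (fun i => U i.succ)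
      (fun i j => hcomm _ _) (fun i => hU _) (fun i => hc _)
    obtain ⟨F, k, hk, hFh, hFi, hFs, hFU, hFc⟩ := exists_eigenProjections hω (hU 0) (hc 0)
    have hFE : ∀ a s, Commute (F a) (E' s) := fun a s =>
      hEc' _ (fun i => (hFc _ (hcomm i.succ 0) a).symm) s
    refine ⟨fun s => F (s 0) * E' (Fin.tail s), Fin.cons k l', ?_, fun s => ?_, fun s => ?_, ?_,
      fun s i => ?_, fun A hA s => ?_⟩
    · intro i
      refine Fin.cases ?_ (fun i => ?_) i
      · simpa using hk
      · simpa using hl' i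
    · rw [conjTranspose_mul, hFh, hEh', ← (hFE _ _).eq]
    · rw [Matrix.mul_assoc, ← Matrix.mul_assoc (E' _), ← (hFE _ _).eq, Matrix.mul_assoc, hEi',
        ← Matrix.mul_assoc, hFi]
    · rw [← (Fin.consEquiv (fun _ : Fin (m + 1) => ZMod d)).sum_comp, Fintype.sum_prod_type]
      have h : ∀ a s, F ((Fin.consEquiv (fun _ : Fin (m + 1) => ZMod d)) (a, s) 0)
          * E' (Fin.tail ((Fin.consEquiv (fun _ : Fin (m + 1) => ZMod d)) (a, s)))
          = F a * E' s := fun _ _ => rfl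
      simp_rw [h, ← Matrix.mul_sum, hEs', Matrix.mul_one, hFs]
    · refine Fin.cases ?_ (fun i => ?_) i
      · rw [← Matrix.mul_assoc, hFU, Matrix.smul_mul, Fin.cons_zero]
      · rw [← Matrix.mul_assoc, (hFc _ (hcomm i.succ 0) (s 0)).eq, Matrix.mul_assoc, hEU',
          Matrix.mul_smul, Fin.cons_succ]
        rfl
    · exact (hFc A (hA 0) _).mul_right (hEc' A (fun i => hA _) _)

end Projections

/-! ### Stabilizer codes -/

section Stabilizer

variable {d : ℕ} [Fact d.Prime] {ω : ℂ} {n m : ℕ}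

/-- The vector of symplectic products of `x` with the generators `g`. -/
def syndrome (g : Fin m → Fin n → Alphabet d) (x : Fin n → Alphabet d) : Fin m → ZMod d :=
  fun i => symplecticForm (g i) x

lemma trace_eq_finrank_range {ι : Type*} [Fintype ι] [DecidableEq ι] {E : Matrix ι ι ℂ}
    (hE : E * E = E) : E.trace = (Module.finrank ℂ (LinearMap.range (Matrix.toLin' E)) : ℂ) := by
  have hp : LinearMap.IsProj (LinearMap.range (Matrix.toLin' E)) (Matrix.toLin' E) := by
    refine ⟨fun x => ⟨x, rfl⟩, ?_⟩
    rintro _ ⟨y, rfl⟩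
    rw [← LinearMap.comp_apply, ← Matrix.toLin'_mul, hE]
  rw [← hp.trace, Matrix.trace_toLin'_eq]

/-- The stabilizer code with generators `g` and decoder `D` corrects the errors `x` that the
decoder guesses correctly from their syndrome. -/
theorem sum_correctable_le_bestFidelity (hω : IsPrimitiveRoot ω d)
    (g : Fin m → Fin n → Alphabet d) (hg : ∀ i j, symplecticForm (g i) (g j) = 0)
    (D : (Fin m → ZMod d) → Fin n → Alphabet d) {p : (Fin n → Alphabet d) → ℝ}
    (hp : ∀ x, 0 ≤ p x) (hp1 : ∑ x, p x = 1) {k : ℝ} (hk : k ≤ n - m) :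
    ∑ x with D (syndrome g x) = x, p x
      ≤ bestFidelity d k (krausMap fun x => (√(p x) : ℂ) • weylTensor ω x) := by
  obtain ⟨E, l, hl, hEh, hEi, hEs, hEU, hEc⟩ := exists_jointProjections hω
    (fun i => weylTensor ω (g i))
    (fun i j => by
      change _ * _ = _ * _
      rw [weylTensor_commute hω, hg]; simp)
    (fun i => conjTranspose_weylTensor_mul_self hω _) (fun i => weylTensor_pow_card hω _)
  have hd1 : 1 < d := (Fact.out : d.Prime).one_lt
  -- Pigeonhole: the `d ^ m` eigenspaces have dimensions adding up to `d ^ n`.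
  have hdim : ∃ s, d ^ n ≤ d ^ m * Module.finrank ℂ (LinearMap.range (Matrix.toLin' (E s))) := by
    by_contra! h
    have h1 : ∑ s, Module.finrank ℂ (LinearMap.range (Matrix.toLin' (E s))) = d ^ n := by
      have h2 : ∑ s, (E s).trace = ((d ^ n : ℕ) : ℂ) := by
        rw [← Matrix.trace_sum, hEs]; simp
      simp_rw [trace_eq_finrank_range (hEi _)] at h2
      exact_mod_cast h2
    have h3 : ∑ s : Fin m → ZMod d,
        d ^ m * Module.finrank ℂ (LinearMap.range (Matrix.toLin' (E s)))
        < ∑ s : Fin m → ZMod d, d ^ n :=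
      Finset.sum_lt_sum_of_nonempty Finset.univ_nonempty fun s _ => h s
    rw [← Finset.mul_sum, h1] at h3
    simp at h3
  obtain ⟨s₀, hs₀⟩ := hdim
  set C := LinearMap.range (Matrix.toLin' (E s₀)) with hC
  have hCpos : 0 < Module.finrank ℂ C := by
    by_contra h0
    have h1 : Module.finrank ℂ C = 0 := by omega
    rw [h1] at hs₀
    have : 0 < d ^ n := by positivity
    omega
  have hCmem : ∀ ψ ∈ C, E s₀ *ᵥ ψ = ψ := by
    rintro _ ⟨φ, rfl⟩
    rw [Matrix.toLin'_apply, Matrix.mulVec_mulVec, hEi]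
  have hCbot : C ≠ ⊥ := by
    intro h
    rw [h] at hCpos
    simp at hCpos
  have hCdim : k ≤ Real.logb d (Module.finrank ℂ C) := by
    refine hk.trans ?_
    have hd0 : (0 : ℝ) < d := by positivity
    rw [Real.le_logb_iff_rpow_le (by exact_mod_cast hd1) (by exact_mod_cast hCpos),
      Real.rpow_sub hd0, Real.rpow_natCast, Real.rpow_natCast, div_le_iff₀' (by positivity)]
    exact_mod_cast hs₀
  -- errors map the code space into the joint eigenspace given by the syndrome
  have herr : ∀ ψ ∈ C, ∀ x, E (s₀ + syndrome g x) *ᵥ (weylTensor ω x *ᵥ ψ)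
      = weylTensor ω x *ᵥ ψ := by
    intro ψ hψ x
    have hzero : ∀ s, s ≠ s₀ + syndrome g x → E s * (weylTensor ω x * E s₀) = 0 := by
      intro s hs
      obtain ⟨i, hi⟩ := Function.ne_iff.mp hs
      have hU : ∀ i, weylTensor ω (g i) * (weylTensor ω x * E s₀)
          = (l i * rootChar hω (s₀ i + syndrome g x i)) • (weylTensor ω x * E s₀) := by
        intro i
        rw [← Matrix.mul_assoc, weylTensor_commute hω, Matrix.smul_mul, Matrix.mul_assoc, hEU,
          Matrix.mul_smul, smul_smul, AddChar.map_add_eq_mul]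
        congr 1
        rw [syndrome]; ring
      have h1 : weylTensor ω (g i) * E s = E s * weylTensor ω (g i) :=
        hEc _ (fun j => by
          change _ * _ = _ * _
          rw [weylTensor_commute hω, hg]; simp) s
      -- The unitary `weylTensor ω (g i)` is evaluated once on `E s` and once on the shifted code
      -- space; distinct eigenvalues force the product to vanish.
      have h2 : (l i * rootChar hω (s i)) • (E s * (weylTensor ω x * E s₀))
          = (l i * rootChar hω (s₀ i + syndrome g x i)) • (E s * (weylTensor ω x * E s₀)) := by
        rw [← Matrix.smul_mul, ← hEU, h1, Matrix.mul_assoc, hU, Matrix.mul_smul]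
      by_contra hne
      have h3 := smul_left_injective ℂ hne h2
      exact hi (rootChar_injective hω (mul_left_cancel₀ (hl i) h3))
    have hsum : E (s₀ + syndrome g x) * (weylTensor ω x * E s₀) = weylTensor ω x * E s₀ := by
      calc _ = ∑ s, E s * (weylTensor ω x * E s₀) :=
            (Finset.sum_eq_single _ (fun s _ hs => hzero s hs) (by simp)).symm
        _ = _ := by rw [← Matrix.sum_mul, hEs, Matrix.one_mul]
    have := congrArg (· *ᵥ ψ) hsum
    simpa only [← Matrix.mulVec_mulVec, hCmem ψ hψ] using this
  -- Recovery: project onto the eigenspace of relative syndrome `s`, then undo the guessed error.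
  let K : (Fin m → ZMod d) → Matrix (Fin n → ZMod d) (Fin n → ZMod d) ℂ :=
    fun s => (weylTensor ω (D s))ᴴ * E (s₀ + s)
  have hK : ∑ s, (K s)ᴴ * K s = 1 := by
    have : ∀ s, (K s)ᴴ * K s = E (s₀ + s) := by
      intro s
      have hN : weylTensor ω (D s) * (weylTensor ω (D s))ᴴ = 1 :=
        mul_eq_one_comm.mp (conjTranspose_weylTensor_mul_self hω (D s))
      simp only [K]
      rw [conjTranspose_mul, conjTranspose_conjTranspose, hEh, Matrix.mul_assoc,
        ← Matrix.mul_assoc (weylTensor ω (D s)), hN, Matrix.one_mul, hEi]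
    simp_rw [this]
    rw [← hEs]
    exact Equiv.sum_comp (Equiv.addLeft s₀) E
  refine le_bestFidelity (sum_weylKraus hω hp hp1) hCbot hCdim (isTPCP_krausMap hK)
    fun ψ hψ hψ1 => ?_
  rw [krausMap_comp, fidelity_krausMap, Fintype.sum_prod_type_right, Finset.sum_filter]
  refine Finset.sum_le_sum fun x _ => ?_
  split_ifs with hx
  -- The Kraus term at the actual syndrome alone contributes `p x`; the others are nonnegative.
  · refine le_trans (le_of_eq ?_) (Finset.single_le_sum
      (fun s _ => Complex.normSq_nonneg _) (Finset.mem_univ (syndrome g x)))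
    have h1 : K (syndrome g x) *ᵥ (weylTensor ω x *ᵥ ψ) = ψ := by
      simp only [K]
      rw [← Matrix.mulVec_mulVec, herr ψ hψ, hx, Matrix.mulVec_mulVec,
        conjTranspose_weylTensor_mul_self hω, Matrix.one_mulVec]
    rw [Matrix.mul_smul, Matrix.smul_mulVec, ← Matrix.mulVec_mulVec, h1, dotProduct_smul, hψ1,
      smul_eq_mul, mul_one, Complex.normSq_ofReal, Real.mul_self_sqrt (hp x)]
  · exact Finset.sum_nonneg fun s _ => Complex.normSq_nonneg _

end Stabilizer

/-! ### Random stabilizer codes -/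

section RandomCode

lemma card_fiber_mul_card {A B : Type*} [AddGroup A] [AddGroup B] [Fintype A] [Fintype B]
    [DecidableEq B] (f : A →+ B) (hf : Function.Surjective f) (b : B) :
    (Finset.univ.filter fun a => f a = b).card * Fintype.card B = Fintype.card A := by
  have h := Finset.card_eq_sum_card_fiberwise (f := f) (s := Finset.univ) (t := Finset.univ)
    (fun _ _ => Finset.mem_coe.mpr (Finset.mem_univ _))
  rw [Finset.sum_congr rfl fun c _ => AddMonoidHom.card_fiber_eq_of_mem_range f (hf c) (hf b)] at h
  rw [← Finset.card_univ (α := A), h, Finset.sum_const, Finset.card_univ, smul_eq_mul, mul_comm]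

variable {d : ℕ} [Fact d.Prime] {n m : ℕ}

/-- The additive group of symmetric matrices over `ZMod d`. -/
def symmetricMatrices (d n : ℕ) : AddSubgroup (Matrix (Fin n) (Fin n) (ZMod d)) where
  carrier := {S | S.IsSymm}
  add_mem' hA hB := hA.add hB
  zero_mem' := Matrix.isSymm_zero
  neg_mem' hA := hA.neg

instance : Fintype (symmetricMatrices d n) := Fintype.ofFinite _

/-- A symmetric matrix together with `m` vectors determines `m` commuting Weyl operators. -/
abbrev CodeSeed (d n m : ℕ) : Type :=
  symmetricMatrices d n × (Fin m → Fin n → ZMod d)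

/-- The stabilizer generators `(v, S v)`. -/
def generators (c : CodeSeed d n m) (i : Fin m) : Fin n → Alphabet d :=
  fun j => (c.2 i j, (c.1.1 *ᵥ c.2 i) j)

/-- The vector `x₂ - S x₁`. -/
def shear (S : symmetricMatrices d n) (x : Fin n → Alphabet d) : Fin n → ZMod d :=
  (fun j => (x j).2) - S.1 *ᵥ fun j => (x j).1

lemma shear_sub (S : symmetricMatrices d n) (x y : Fin n → Alphabet d) :
    shear S (x - y) = shear S x - shear S y := by
  have h1 : (fun j => ((x - y) j).1) = (fun j => (x j).1) - fun j => (y j).1 := rfl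
  have h2 : (fun j => ((x - y) j).2) = (fun j => (x j).2) - fun j => (y j).2 := rfl
  rw [shear, shear, shear, h1, h2, Matrix.mulVec_sub]
  abel

/-- Symmetry of `S` moves it from `v` onto `x₁`, so the syndrome depends on `x` only through its
deviation from the graph of `S`. -/
lemma symplecticForm_generators (c : CodeSeed d n m) (i : Fin m) (x : Fin n → Alphabet d) :
    symplecticForm (generators c i) x = c.2 i ⬝ᵥ shear c.1 x := by
  have h1 : crossForm x (generators c i) = c.2 i ⬝ᵥ fun j => (x j).2 := by
    rw [dotProduct_comm]; rfl
  have h2 : crossForm (generators c i) x = (c.1.1 *ᵥ c.2 i) ⬝ᵥ fun j => (x j).1 := rfl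
  have hS : c.1.1ᵀ = c.1.1 := c.1.2
  rw [symplecticForm, h1, h2, shear, dotProduct_sub, dotProduct_mulVec, ← Matrix.mulVec_transpose, hS]

lemma symplecticForm_generators_self (c : CodeSeed d n m) (i j : Fin m) :
    symplecticForm (generators c i) (generators c j) = 0 := by
  have : shear c.1 (generators c j) = 0 := sub_self _
  rw [symplecticForm_generators, this, dotProduct_zero]

lemma syndrome_generators_eq_iff (c : CodeSeed d n m) (x y : Fin n → Alphabet d) :
    syndrome (generators c) x = syndrome (generators c) y
      ↔ ∀ i, c.2 i ⬝ᵥ shear c.1 (x - y) = 0 := by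
  simp only [funext_iff, syndrome, symplecticForm_generators, shear_sub, dotProduct_sub,
    sub_eq_zero]

lemma card_orthogonal_mul {v : Fin n → ZMod d} (hv : v ≠ 0) :
    (Finset.univ.filter fun G : Fin m → Fin n → ZMod d => ∀ i, G i ⬝ᵥ v = 0).card * d ^ m
      = Fintype.card (Fin m → Fin n → ZMod d) := by
  let f : (Fin m → Fin n → ZMod d) →+ (Fin m → ZMod d) :=
    { toFun := fun G i => G i ⬝ᵥ v
      map_zero' := by funext i; simp
      map_add' := fun G H => by funext i; simp [add_dotProduct] }
  have hf : Function.Surjective f := by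
    intro b
    obtain ⟨j, hj⟩ := Function.ne_iff.mp hv
    refine ⟨fun i => Pi.single j (b i * (v j)⁻¹), funext fun i => ?_⟩
    have hj' : v j ≠ 0 := hj
    simp [f, hj']
  have h := card_fiber_mul_card f hf 0
  rw [← h]
  congr 1
  · congr 1
    ext G
    simp [f, funext_iff]
  · simp

/-- With `e` a basis vector at a nonzero coordinate `v j`, symmetrizing `b eᵀ / v j` adds a multiple
of `e` to the value at `v`; the `e eᵀ` term cancels it. Nothing is divided by `2`, so `d = 2` is
covered. -/
lemma exists_symmetric_mulVec_eq {v : Fin n → ZMod d} (hv : v ≠ 0) (b : Fin n → ZMod d) :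
    ∃ S : symmetricMatrices d n, S.1 *ᵥ v = b := by
  obtain ⟨j, hj⟩ := Function.ne_iff.mp hv
  have hj' : v j ≠ 0 := hj
  let e : Fin n → ZMod d := Pi.single j 1
  have he : e ⬝ᵥ v = v j := by simp [e]
  refine ⟨⟨(v j)⁻¹ • (vecMulVec b e + vecMulVec e b)
    - ((v j)⁻¹ * (v j)⁻¹ * (b ⬝ᵥ v)) • vecMulVec e e, ?_⟩, ?_⟩
  · change Matrix.transpose _ = _
    simp only [transpose_sub, transpose_smul, transpose_add, transpose_vecMulVec]
    rw [add_comm]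
  · simp only [sub_mulVec, smul_mulVec, add_mulVec, vecMulVec_mulVec, he]
    funext i
    simp only [Pi.sub_apply, Pi.smul_apply, Pi.add_apply, smul_eq_mul, MulOpposite.smul_eq_mul_unop,
      MulOpposite.unop_op]
    field_simp
    ring

lemma card_symmetric_mulVec_eq_mul {v : Fin n → ZMod d} (hv : v ≠ 0) (b : Fin n → ZMod d) :
    (Finset.univ.filter fun S : symmetricMatrices d n => S.1 *ᵥ v = b).card * d ^ n
      = Fintype.card (symmetricMatrices d n) := by
  let f : symmetricMatrices d n →+ (Fin n → ZMod d) :=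
    { toFun := fun S => S.1 *ᵥ v
      map_zero' := by simp
      map_add' := fun S T => by simp [add_mulVec] }
  have h := card_fiber_mul_card f (exists_symmetric_mulVec_eq hv) b
  rw [← h]
  congr 1
  simp

/-- A nonzero error is undetected by a random code with probability at most `2 d^(-m)`. -/
lemma card_undetected_mul_le (hmn : m ≤ n) {z : Fin n → Alphabet d} (hz : z ≠ 0) :
    (Finset.univ.filter fun c : CodeSeed d n m => ∀ i, c.2 i ⬝ᵥ shear c.1 z = 0).card * d ^ m
      ≤ 2 * Fintype.card (CodeSeed d n m) := by
  set G := Fintype.card (Fin m → Fin n → ZMod d) with hG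
  have hzero : (Finset.univ.filter fun S : symmetricMatrices d n => shear S z = 0).card * d ^ m
      ≤ Fintype.card (symmetricMatrices d n) := by
    have hiff : ∀ S : symmetricMatrices d n, shear S z = 0
        ↔ S.1 *ᵥ (fun j => (z j).1) = fun j => (z j).2 := fun S => by
      rw [shear, sub_eq_zero, eq_comm]
    simp_rw [hiff]
    -- If `z₁ = 0` then `z₂ ≠ 0` and no `S` works; otherwise `S z₁` is uniform, giving proportion
    -- `d^(-n) ≤ d^(-m)`.
    by_cases h1 : (fun j => (z j).1) = 0
    · have : (Finset.univ.filter fun S : symmetricMatrices d n =>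
          S.1 *ᵥ (fun j => (z j).1) = fun j => (z j).2) = ∅ := by
        refine Finset.filter_eq_empty_iff.mpr fun S _ hS => hz ?_
        rw [h1, Matrix.mulVec_zero] at hS
        funext j
        exact Prod.ext (congrFun h1 j) (congrFun hS j).symm
      rw [this]; simp
    · rw [← card_symmetric_mulVec_eq_mul h1 fun j => (z j).2]
      exact Nat.mul_le_mul_left _ (Nat.pow_le_pow_right (NeZero.pos d) hmn)
  have hcard : (Finset.univ.filter fun c : CodeSeed d n m =>
        ∀ i, c.2 i ⬝ᵥ shear c.1 z = 0).card
      = ∑ S : symmetricMatrices d n, (Finset.univ.filter fun H : Fin m → Fin n → ZMod d =>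
        ∀ i, H i ⬝ᵥ shear S z = 0).card := by
    simp_rw [Finset.card_filter]
    rw [Fintype.sum_prod_type]
  -- For `z` off the graph of `S`, random vectors are all orthogonal to the shear with probability
  -- `d^(-m)`; on the graph the trivial bound is used. The two cases produce the factor `2`.
  have hS : ∀ S : symmetricMatrices d n, (Finset.univ.filter fun H : Fin m → Fin n → ZMod d =>
        ∀ i, H i ⬝ᵥ shear S z = 0).card * d ^ m
      ≤ (if shear S z = 0 then 1 else 0) * d ^ m * G + G := by
    intro S
    by_cases h : shear S z = 0
    · have : (Finset.univ.filter fun H : Fin m → Fin n → ZMod d =>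
        ∀ i, H i ⬝ᵥ shear S z = 0).card ≤ G := Finset.card_le_univ _
      rw [if_pos h]
      nlinarith [Nat.mul_le_mul_right (d ^ m) this]
    · rw [card_orthogonal_mul h]
      exact Nat.le_add_left _ _
  rw [hcard, Finset.sum_mul]
  refine (Finset.sum_le_sum fun S _ => hS S).trans ?_
  rw [Finset.sum_add_distrib, ← Finset.sum_mul, ← Finset.sum_mul, ← Finset.card_filter,
    Finset.sum_const, Finset.card_univ, smul_eq_mul, Fintype.card_prod, ← hG]
  nlinarith [Nat.mul_le_mul_right G hzero]

/-- Decoding by the smallest score `h` fails only if the error `x` is confused with another error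
of at most the same score. -/
lemma one_sub_bestFidelity_le_of_seed {ω : ℂ} (hω : IsPrimitiveRoot ω d) (c : CodeSeed d n m)
    {p : (Fin n → Alphabet d) → ℝ} (hp : ∀ x, 0 ≤ p x) (hp1 : ∑ x, p x = 1) {k : ℝ}
    (hk : k ≤ n - m) (h : (Fin n → Alphabet d) → ℝ) [DecidablePred fun x => ∃ y, y ≠ x ∧
      h y ≤ h x ∧ syndrome (generators c) y = syndrome (generators c) x] :
    1 - bestFidelity d k (krausMap fun x => (√(p x) : ℂ) • weylTensor ω x)
      ≤ ∑ x with ∃ y, y ≠ x ∧ h y ≤ h x ∧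
        syndrome (generators c) y = syndrome (generators c) x, p x := by
  have hD : ∀ s, ∃ y, ∀ x, syndrome (generators c) x = s →
      syndrome (generators c) y = s ∧ h y ≤ h x := by
    intro s
    rcases (Finset.univ.filter fun x => syndrome (generators c) x = s).eq_empty_or_nonempty
      with h0 | h0
    -- For a syndrome that never occurs the guess is irrelevant.
    · exact ⟨0, fun x hx => absurd hx (Finset.filter_eq_empty_iff.mp h0 (Finset.mem_univ x))⟩
    · obtain ⟨y, hy, hmin⟩ := Finset.exists_min_image _ h h0
      exact ⟨y, fun x hx => ⟨(Finset.mem_filter.mp hy).2, hmin x (by simpa using hx)⟩⟩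
  choose D hD using hD
  have h1 := sum_correctable_le_bestFidelity hω (generators c) (symplecticForm_generators_self c) D
    hp hp1 hk
  have h2 : ∑ x with ¬ D (syndrome (generators c) x) = x, p x
      ≤ ∑ x with ∃ y, y ≠ x ∧ h y ≤ h x ∧
        syndrome (generators c) y = syndrome (generators c) x, p x := by
    refine Finset.sum_le_sum_of_subset_of_nonneg (fun x hx => ?_) fun x _ _ => hp x
    obtain ⟨h3, h4⟩ := hD _ x rfl
    simp only [Finset.mem_filter, Finset.mem_univ, true_and] at hx ⊢
    exact ⟨_, hx, h4, h3⟩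
  have h3 := Finset.sum_filter_add_sum_filter_not Finset.univ
    (fun x => D (syndrome (generators c) x) = x) p
  rw [hp1] at h3
  linarith

/-- The random coding bound. -/
theorem one_sub_bestFidelity_le {ω : ℂ} (hω : IsPrimitiveRoot ω d) (hmn : m ≤ n)
    {p : (Fin n → Alphabet d) → ℝ} (hp : ∀ x, 0 ≤ p x) (hp1 : ∑ x, p x = 1) {k : ℝ}
    (hk : k ≤ n - m) (h : (Fin n → Alphabet d) → ℝ) :
    1 - bestFidelity d k (krausMap fun x => (√(p x) : ℂ) • weylTensor ω x)
      ≤ ∑ x, p x * min 1 (2 / (d : ℝ) ^ m * (Finset.univ.filter fun y => h y ≤ h x).card) := by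
  classical
  let bad (c : CodeSeed d n m) (x : Fin n → Alphabet d) : Prop := ∃ y, y ≠ x ∧ h y ≤ h x ∧
    syndrome (generators c) y = syndrome (generators c) x
  set T := Fintype.card (CodeSeed d n m)
  have hd : (0 : ℝ) < (d : ℝ) ^ m := pow_pos (Nat.cast_pos.mpr (NeZero.pos d)) m
  have hbad : ∀ x, ((Finset.univ.filter fun c => bad c x).card : ℝ)
      ≤ T * min 1 (2 / (d : ℝ) ^ m * (Finset.univ.filter fun y => h y ≤ h x).card) := by
    intro x
    rw [mul_min_of_nonneg _ _ (Nat.cast_nonneg T)]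
    refine le_min ?_ ?_
    · rw [mul_one]
      exact_mod_cast Finset.card_le_univ _
    · have hsub : (Finset.univ.filter fun c => bad c x)
          ⊆ (Finset.univ.filter fun y => y ≠ x ∧ h y ≤ h x).biUnion fun y =>
            Finset.univ.filter fun c : CodeSeed d n m => ∀ i, c.2 i ⬝ᵥ shear c.1 (y - x) = 0 := by
        intro c hc
        obtain ⟨y, hyx, hy, hs⟩ := (Finset.mem_filter.mp hc).2
        exact Finset.mem_biUnion.mpr ⟨y, by simp [hyx, hy], by
          simpa using (syndrome_generators_eq_iff c y x).mp hs⟩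
      have hle := (Finset.card_le_card hsub).trans Finset.card_biUnion_le
      calc ((Finset.univ.filter fun c => bad c x).card : ℝ)
          ≤ ∑ y with y ≠ x ∧ h y ≤ h x, ((Finset.univ.filter fun c : CodeSeed d n m =>
            ∀ i, c.2 i ⬝ᵥ shear c.1 (y - x) = 0).card : ℝ) := by exact_mod_cast hle
        _ ≤ ∑ y with y ≠ x ∧ h y ≤ h x, 2 / (d : ℝ) ^ m * T := by
            refine Finset.sum_le_sum fun y hy => ?_
            rw [div_mul_eq_mul_div, le_div_iff₀ hd]
            exact_mod_cast card_undetected_mul_le hmn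
              (sub_ne_zero.mpr (Finset.mem_filter.mp hy).2.1)
        _ ≤ ∑ y with h y ≤ h x, 2 / (d : ℝ) ^ m * T := by
            refine Finset.sum_le_sum_of_subset_of_nonneg (fun y hy => ?_)
              fun y _ _ => by positivity
            simp only [Finset.mem_filter, Finset.mem_univ, true_and] at hy ⊢
            exact hy.2
        _ = _ := by
            rw [Finset.sum_const, nsmul_eq_mul]
            ring
  have hsum : ∑ c : CodeSeed d n m, ∑ x with bad c x, p x
      ≤ ∑ _c : CodeSeed d n m, ∑ x, p x *
        min 1 (2 / (d : ℝ) ^ m * (Finset.univ.filter fun y => h y ≤ h x).card) := by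
    rw [Finset.sum_const, nsmul_eq_mul, Finset.mul_sum]
    simp_rw [Finset.sum_filter]
    rw [Finset.sum_comm]
    refine Finset.sum_le_sum fun x _ => ?_
    rw [← Finset.sum_filter, Finset.sum_const, nsmul_eq_mul, Finset.card_univ, mul_comm,
      mul_left_comm]
    exact mul_le_mul_of_nonneg_left (hbad x) (hp x)
  -- Some seed does at least as well as the average.
  obtain ⟨c, -, hc⟩ := Finset.exists_le_of_sum_le Finset.univ_nonempty hsum
  exact (one_sub_bestFidelity_le_of_seed hω c hp hp1 hk h).trans hc

end RandomCode

/-! ### The error exponent -/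

/-- At `x = 0` the logarithm is `⊥`, and the negative factor turns it into `⊤`. -/
lemma coe_le_neg_inv_mul_elogb {d n : ℕ} (hd : 1 < d) (hn : 0 < n) {x e : ℝ} (hx0 : 0 ≤ x)
    (hx : x ≤ (d : ℝ) ^ (-(n * e))) : (e : EReal) ≤ ((-(1 / (n : ℝ)) : ℝ) : EReal) * elogb d x := by
  have hn' : (0 : ℝ) < n := Nat.cast_pos.mpr hn
  unfold elogb
  split_ifs with h
  · rw [EReal.coe_mul_bot_of_neg (by simpa using hn')]
    exact le_top
  · rw [← EReal.coe_mul, EReal.coe_le_coe_iff]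
    have h1 : Real.logb d x ≤ -(n * e) :=
      (Real.logb_le_iff_le_rpow (by exact_mod_cast hd) (lt_of_le_of_ne hx0 (Ne.symm h))).mpr hx
    have h2 : (1 / (n : ℝ)) * Real.logb d x ≤ (1 / (n : ℝ)) * -(n * e) :=
      mul_le_mul_of_nonneg_left h1 (by positivity)
    have h3 : (1 / (n : ℝ)) * -(n * e) = -e := by field_simp
    linarith

/-- The gap `e - e'` absorbs the polynomial; having `n - 1` in place of `n` costs only the constant
`d ^ e`. -/
lemma eventually_poly_mul_rpow_le {d : ℕ} (hd : 1 < d) (A : ℝ) (k : ℕ) {e e' : ℝ} (he : e' < e) :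
    ∀ᶠ n : ℕ in atTop, A * (n : ℝ) ^ k * (d : ℝ) ^ (-(((n : ℝ) - 1) * e))
      ≤ (d : ℝ) ^ (-(n * e')) := by
  have hd0 : (0 : ℝ) < d := by positivity
  have hr : 1 < (d : ℝ) ^ (e - e') :=
    Real.one_lt_rpow (by exact_mod_cast hd) (sub_pos.mpr he)
  have h := (tendsto_pow_const_div_const_pow_of_one_lt k hr).const_mul (A * (d : ℝ) ^ e)
  rw [mul_zero] at h
  filter_upwards [h.eventually_le_const one_pos] with n hn
  have h1 : A * (n : ℝ) ^ k * (d : ℝ) ^ (-(((n : ℝ) - 1) * e))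
      = A * (d : ℝ) ^ e * ((n : ℝ) ^ k / ((d : ℝ) ^ (e - e')) ^ n) * (d : ℝ) ^ (-(n * e')) := by
    have h2 : (d : ℝ) ^ (-(((n : ℝ) - 1) * e))
        = (d : ℝ) ^ e * (((d : ℝ) ^ (e - e')) ^ n)⁻¹ * (d : ℝ) ^ (-(n * e')) := by
      rw [← Real.rpow_natCast, ← Real.rpow_mul hd0.le, ← Real.rpow_neg hd0.le,
        ← Real.rpow_add hd0, ← Real.rpow_add hd0]
      congr 1; ring
    rw [h2]; ring
  rw [h1]
  exact mul_le_of_le_one_left (by positivity) hn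

variable {d : ℕ} [Fact d.Prime] {ω : ℂ} {p : Alphabet d → ℝ} {P : Alphabet d → Alphabet d → ℝ}

lemma bestFidelity_markovChannel_le_one (hω : IsPrimitiveRoot ω d)
    (hp : p ∈ stdSimplex ℝ (Alphabet d)) (hP : ∀ u, P u ∈ stdSimplex ℝ (Alphabet d)) (n : ℕ)
    (k : ℝ) : bestFidelity d k (markovChannel ω p P n) ≤ 1 :=
  bestFidelity_le_one (sum_weylKraus hω (markovDist_nonneg hp hP n) (sum_markovDist hp hP n)) d k

/-- The random coding bound for the Markovian channel in terms of types. -/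
lemma one_sub_bestFidelity_markovChannel_le (hω : IsPrimitiveRoot ω d)
    (hp : p ∈ stdSimplex ℝ (Alphabet d)) (hP : ∀ u, P u ∈ stdSimplex ℝ (Alphabet d))
    {R e : ℝ} (hR0 : 0 ≤ R) (hR1 : R ≤ 1) {m : ℕ} (hm : 0 < m)
    (he : ∀ x : Fin (m + 1) → Alphabet d, pairType x ∈ supported P →
      e ≤ realObjective d R P (pairType x)) :
    1 - bestFidelity d (R * (m + 1 : ℕ)) (markovChannel ω p P (m + 1))
      ≤ 2 * d * ((m + 1) ^ Fintype.card (Alphabet d × Alphabet d) *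
        Fintype.card (Alphabet d)) ^ 2 * (d : ℝ) ^ (-(m * e)) := by
  have hd : 1 < d := (Fact.out : d.Prime).one_lt
  have hd1 : (1 : ℝ) ≤ d := by exact_mod_cast hd.le
  have hd0 : (0 : ℝ) < d := by positivity
  set k := ⌈R * (m + 1 : ℕ)⌉₊
  have hk : k ≤ m + 1 := Nat.ceil_le.mpr (mul_le_of_le_one_left (Nat.cast_nonneg _) hR1)
  have hk1 : R * (m + 1 : ℕ) ≤ k := Nat.le_ceil _
  have hk2 : (k : ℝ) < R * (m + 1 : ℕ) + 1 := Nat.ceil_lt_add_one (by positivity)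
  have h1 := one_sub_bestFidelity_le hω (Nat.sub_le (m + 1) k)
    (markovDist_nonneg hp hP (m + 1)) (sum_markovDist hp hP (m + 1))
    (k := R * (m + 1 : ℕ)) (by rw [Nat.cast_sub hk]; linarith) (typeEntropy d)
  refine h1.trans (sum_markovDist_mul_min_le hd hm hp hP (by positivity) (by linarith) ?_ he)
  -- Rounding `R n` up to `k` and passing from `n = m + 1` letters to `m` transitions together cost
  -- at most one factor `d`; hence the constant `2 d`.
  have h2 : ((d : ℝ) ^ (m + 1 - k))⁻¹ ≤ d * (d : ℝ) ^ (-(m * (1 - R))) := by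
    rw [← Real.rpow_natCast, ← Real.rpow_neg hd0.le]
    nth_rw 2 [← Real.rpow_one (d : ℝ)]
    rw [← Real.rpow_add hd0]
    refine Real.rpow_le_rpow_of_exponent_le hd1 ?_
    rw [Nat.cast_sub hk]
    push_cast at hk2 ⊢
    linarith
  rw [div_eq_mul_inv, mul_assoc]
  exact mul_le_mul_of_nonneg_left h2 zero_le_two

/-- Every value below the exponent is eventually a lower bound. -/
lemma eventually_le_errorExponent (hω : IsPrimitiveRoot ω d)
    (hp : p ∈ stdSimplex ℝ (Alphabet d)) (hP : ∀ u, P u ∈ stdSimplex ℝ (Alphabet d))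
    {R e e' : ℝ} (hR0 : 0 ≤ R) (hR1 : R ≤ 1) (hee : e' < e)
    (he : ∀ Q ∈ balanced (Alphabet d), (e : EReal) < exponentObjective d R P Q) :
    ∀ᶠ n : ℕ in atTop, (e' : EReal) ≤ ((-(1 / (n : ℝ)) : ℝ) : EReal) *
      elogb d (1 - bestFidelity d (R * n) (markovChannel ω p P n)) := by
  have hd : 1 < d := (Fact.out : d.Prime).one_lt
  obtain ⟨δ, hδ, hlt⟩ := exists_pos_lt_realObjective d R P he
  set N := Fintype.card (Alphabet d × Alphabet d)
  set M : ℝ := (Fintype.card (Alphabet d) : ℝ)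
  have h1 : ∀ᶠ m : ℕ in atTop, 1 / (m : ℝ) < δ :=
    tendsto_one_div_atTop_nhds_zero_nat.eventually_lt_const hδ
  have h2 := (tendsto_sub_atTop_nat 1).eventually h1
  filter_upwards [h2, eventually_poly_mul_rpow_le hd (2 * d * M ^ 2) (N * 2) hee,
    eventually_gt_atTop 1] with n hn hpoly hn1
  obtain ⟨m, rfl⟩ : ∃ m, n = m + 1 := ⟨n - 1, by omega⟩
  rw [Nat.add_sub_cancel] at hn
  have hm : 0 < m := by omega
  refine coe_le_neg_inv_mul_elogb hd (Nat.succ_pos m)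
    (sub_nonneg.mpr (bestFidelity_markovChannel_le_one hω hp hP _ _)) ?_
  refine (one_sub_bestFidelity_markovChannel_le hω hp hP hR0 hR1 hm fun x hx =>
    (hlt _ hx fun u => (abs_marginal_sub_le x u).trans_lt hn).le).trans (le_trans (le_of_eq ?_) hpoly)
  push_cast
  rw [add_sub_cancel_right, mul_pow, ← pow_mul]
  ring

end WeylChannel

end

theorem theorem1 (d : ℕ) [Fact d.Prime] (ω : ℂ) (hω : IsPrimitiveRoot ω d)
    (p : WeylChannel.Alphabet d → ℝ) (hp : p ∈ stdSimplex ℝ (WeylChannel.Alphabet d))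
    (P : WeylChannel.Alphabet d → WeylChannel.Alphabet d → ℝ)
    (hP : ∀ u, P u ∈ stdSimplex ℝ (WeylChannel.Alphabet d))
    (R : ℝ) (hR0 : 0 ≤ R) (hR1 : R ≤ 1) :
    ∃ E : EReal,
      IsLeast (WeylChannel.exponentObjective d R P ''
        WeylChannel.balanced (WeylChannel.Alphabet d)) E ∧
      E ≤ Filter.liminf (fun n : ℕ => ((-(1 / (n : ℝ)) : ℝ) : EReal) *
        WeylChannel.elogb d
          (1 - WeylChannel.bestFidelity d (R * n) (WeylChannel.markovChannel ω p P n)))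
        Filter.atTop := by
  obtain ⟨E, hE⟩ := WeylChannel.exists_isLeast_exponentObjective d R P
  refine ⟨E, hE, le_of_forall_lt_imp_le_of_dense fun c hc => ?_⟩
  -- Two reals are placed between `c` and `E`: `e < E` leaves room for almost balanced types, and
  -- `e' < e` for the polynomial factor.
  obtain ⟨e', hce', he'⟩ := EReal.lt_iff_exists_real_btwn.mp hc
  obtain ⟨e, hee, he⟩ := EReal.lt_iff_exists_real_btwn.mp he'
  refine hce'.le.trans (Filter.le_liminf_of_le (by isBoundedDefault) ?_)
  exact WeylChannel.eventually_le_errorExponent hω hp hP hR0 hR1 (EReal.coe_lt_coe_iff.mp hee)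
    fun Q hQ => he.trans_le (hE.2 ⟨Q, hQ, rfl⟩)
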